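/- **Setting.** Let $c^*\in\mathbb{R}$ and $\gamma\in[0,1]$ be fixed, belonging to one of the cases: $\gamma=0$ and $c^*\in(-2,0)$; or $\gamma\in(0,1)$ and $c^*<0$; or $\gamma=1$ and $c^*\in\mathbb{R}$. Put $\rho^*=\rho^*_T=1+c^*/T^{\gamma}$. For individuals $i\ge 1$ the observables are $x_{i,t}=\alpha_i+\delta_{i,t}$ with $\delta_{i,t+1}=\rho^*\delta_{i,t}+v_{i,t+1}$ for $t\ge 0$; the drift $\alpha_i$ and the initial value $\delta_{i,0}$ are random variables that may depend on $T$. Let $w_{i,t}=(e_{i,t},v_{i,t})'$, $t\ge1$, be the shocks and $\mathcal F_{i,t}=\sigma(\delta_{i,0},\alpha_i,w_{i,1},\dots,w_{i,t})$. Assume: 1. (Initial values and drift.) Uniformly over $i$: $\mathbb{E}(\delta_{i,0}\mid\alpha_i)=0$; for some fixed $\varepsilon>0$, $\mathbb{E}(\delta_{i,0}^2)=O(|1-\rho^*|^{-1}\wedge T^{1-\varepsilon})$; $\mathbb{E}(\delta_{i,0}^4)$ and $\mathbb{E}(\alpha_i^4)$ are finite and $\mathbb{E}(\delta_{i,0}^4+\alpha_i^4)=O(|1-\rho^*|^{-2}\wedge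 T^2)$, as $T\to\infty$ (with $1/0=\infty$). 2. (Innovations.) For each $T$ the triples $(\delta_{i,0},\alpha_i,\{w_{i,t}\}_{t\ge1})$ are independent across $i$, and the sequences $\{w_{i,t}\}_{t\ge1}$ are identically distributed across $i$. For each $i$, $\{w_{i,t}\}_{t\ge1}$ is strictly stationary and ergodic, $\mathbb{E}(w_{i,t}\mid\mathcal F_{i,t-1})=0$, $\mathbb{E}(w_{i,t}w_{i,t}'\mid\mathcal F_{i,t-1})=\Omega^*$ for a constant positive definite matrix $\Omega^*$, and $\mathbb{E}\|w_{i,t}\|^4<C_w<\infty$ for a constant $C_w$. **Estimator.** For even $T$ let $\mathcal O=\{3,5,\dots,T-1\}$, $\mathcal E=\{2,4,\dots,T-2\}$, let $\tilde x^{\mathcal I}_{i,t}=x_{i,t}-\frac{2}{T-2}\sum_{s\in\mathcal I}x_{i,s}$ for $\mathcal I\in\{\mathcal O,\mathcal E\}$, and $$\eta_{i,T}=\frac{2}{T-2}\Bigl(x_{i,1}\sum_{t\in\mathcal E}x_{i,t}+x_{i,2}\sum_{t\in\mathcal O}x_{i,t-2}\Bigr).$$ The X-Jackknife estimator is $$\hat\rho^{\,\mathrm{XJ}}=\frac{\sum_{i=1}^n\Bigl[\sum_{t\in\mathcal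 O}\tilde x^{\mathcal O}_{i,t}x_{i,t+1}+\sum_{t\in\mathcal E}\tilde x^{\mathcal E}_{i,t}x_{i,t+1}+\frac{4}{T-2}\sum_{t=1}^{(T-2)/2}x_{i,t}x_{i,t+1}-\eta_{i,T}\Bigr]}{\sum_{i=1}^n\Bigl[\sum_{t\in\mathcal O}(\tilde x^{\mathcal O}_{i,t})^2+\sum_{t\in\mathcal E}(\tilde x^{\mathcal E}_{i,t})^2\Bigr]}.$$ **Proposition.** As $(n,T)\to\infty$ jointly, with no restriction on the relative rates and $T$ even, $$\hat\rho^{\,\mathrm{XJ}}-\rho^*=O_p\Bigl(\frac{1}{\sqrt{nT^{1+\gamma}}}+\frac{1}{T^2}\Bigr),$$ that is, for every $\epsilon>0$ there are $M$ and $N$ such that $\Pr\bigl(|\hat\rho^{\,\mathrm{XJ}}-\rho^*|>M\,[(nT^{1+\gamma})^{-1/2}+T^{-2}]\bigr)\le\epsilon$ for all $n\ge N$ and all even $T\ge N$. -/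

import Mathlib

open MeasureTheory ProbabilityTheory Filter Topology

namespace XJ

/-- The autoregressive coefficient `ρ*_T = 1 + c* / T ^ γ` at sample length `T`. -/
noncomputable def rhoStar (c γ : ℝ) (T : ℕ) : ℝ := 1 + c / (T : ℝ) ^ γ

/-- The admissible pairs `(c*, γ)`: stationary (`γ = 0`, `-2 < c* < 0`), mildly integrated
(`0 < γ < 1`, `c* < 0`) and local to unity (`γ = 1`, any `c*`: locally integrated, unit root
or locally explosive). -/
def Admissible (c γ : ℝ) : Prop :=
  (γ = 0 ∧ -2 < c ∧ c < 0) ∨ (0 < γ ∧ γ < 1 ∧ c < 0) ∨ γ = 1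

/-- The state `δ_t` with `δ_{t+1} = ρ δ_t + v_{t+1}`, started at `δ_0`. -/
def state (ρ δ₀ : ℝ) (v : ℕ → ℝ) : ℕ → ℝ
  | 0 => δ₀
  | t + 1 => ρ * state ρ δ₀ v t + v (t + 1)

/-- The observable `x_t = α + δ_t`. -/
def observable (ρ α δ₀ : ℝ) (v : ℕ → ℝ) (t : ℕ) : ℝ := α + state ρ δ₀ v t

/-! ### The X-Jackknife estimator, for a panel `x i t` -/

/-- The odd indices `{3, 5, …, T - 1}`, for even `T`. -/
def oddIdx (T : ℕ) : Finset ℕ := (Finset.Icc 3 (T - 1)).filter Odd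

/-- The even indices `{2, 4, …, T - 2}`, for even `T`. -/
def evenIdx (T : ℕ) : Finset ℕ := (Finset.Icc 2 (T - 2)).filter Even

/-- The value `x_t` minus the average of `x` over an index set `I` with `(T - 2) / 2` elements. -/
noncomputable def demean (T : ℕ) (I : Finset ℕ) (x : ℕ → ℝ) (t : ℕ) : ℝ :=
  x t - 2 / ((T : ℝ) - 2) * ∑ s ∈ I, x s

/-- The correction `η_{i,T}` for the initial observations. -/
noncomputable def eta (T : ℕ) (x : ℕ → ℝ) : ℝ :=
  2 / ((T : ℝ) - 2) * (x 1 * ∑ t ∈ evenIdx T, x t + x 2 * ∑ t ∈ oddIdx T, x (t - 2))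

/-- The contribution of one individual to the numerator of the estimator. -/
noncomputable def numer (T : ℕ) (x : ℕ → ℝ) : ℝ :=
  ∑ t ∈ oddIdx T, demean T (oddIdx T) x t * x (t + 1)
    + ∑ t ∈ evenIdx T, demean T (evenIdx T) x t * x (t + 1)
    + 4 / ((T : ℝ) - 2) * ∑ t ∈ Finset.Icc 1 ((T - 2) / 2), x t * x (t + 1)
    - eta T x

/-- The contribution of one individual to the denominator of the estimator. -/
noncomputable def denom (T : ℕ) (x : ℕ → ℝ) : ℝ :=
  ∑ t ∈ oddIdx T, demean T (oddIdx T) x t ^ 2 + ∑ t ∈ evenIdx T, demean T (evenIdx T) x t ^ 2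

/-- The X-Jackknife estimator from a panel of `n` individuals (numbered `0, …, n - 1`) and
`T` periods (numbered `1, …, T`), for even `T`. -/
noncomputable def estimator (n T : ℕ) (x : ℕ → ℕ → ℝ) : ℝ :=
  (∑ i ∈ Finset.range n, numer T (x i)) / ∑ i ∈ Finset.range n, denom T (x i)

/-! ### Assumptions on the data generating mechanism -/

/-- `d⁻¹ ∧ b` with the convention `1 / 0 = ∞`. -/
noncomputable def invMin (d b : ℝ) : ℝ := if d = 0 then b else min d⁻¹ b

/-- The shocks `w_{i,t} = (e_{i,t}, v_{i,t})` take values in the Euclidean plane; coordinate `0`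
is `e` and coordinate `1` is `v`. -/
abbrev Plane := EuclideanSpace ℝ (Fin 2)

/-- The sigma-field `F_t = σ(δ_0, α, w_1, …, w_t)` of one individual. -/
@[reducible]
def past {Ω : Type*} (δ₀ α : Ω → ℝ) (w : ℕ → Ω → Plane) (t : ℕ) : MeasurableSpace Ω :=
  MeasurableSpace.comap δ₀ inferInstance ⊔ MeasurableSpace.comap α inferInstance ⊔
    ⨆ s ∈ Set.Icc 1 t, MeasurableSpace.comap (w s) inferInstance

/-- Initial values and drift. The variables `δ₀ T i` and `α T i` may depend on the sample
length `T`; the moment bounds hold uniformly in the individual `i`. -/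
structure InitialValues {Ω : Type*} [MeasurableSpace Ω] (μ : Measure Ω) (c γ : ℝ)
    (δ₀ α : ℕ → ℕ → Ω → ℝ) : Prop where
  measurable_init : ∀ T i, Measurable (δ₀ T i)
  measurable_drift : ∀ T i, Measurable (α T i)
  memLp_init : ∀ T i, MemLp (δ₀ T i) 4 μ
  memLp_drift : ∀ T i, MemLp (α T i) 4 μ
  condExp_init : ∀ T i, μ[δ₀ T i | MeasurableSpace.comap (α T i) inferInstance] =ᵐ[μ] 0
  second_moment : ∃ ε : ℝ, 0 < ε ∧ ∃ C : ℝ, ∀ᶠ T : ℕ in atTop, ∀ i,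
    ∫ ω, δ₀ T i ω ^ 2 ∂μ ≤ C * invMin |1 - rhoStar c γ T| ((T : ℝ) ^ (1 - ε))
  fourth_moment : ∃ C : ℝ, ∀ᶠ T : ℕ in atTop, ∀ i,
    ∫ ω, (δ₀ T i ω ^ 4 + α T i ω ^ 4) ∂μ
      ≤ C * invMin (|1 - rhoStar c γ T| ^ 2) ((T : ℝ) ^ 2)

/-- Innovations `w i t`, `t ≥ 1` (the value at `t = 0` is never used). -/
structure Innovations {Ω : Type*} [MeasurableSpace Ω] (μ : Measure Ω) (δ₀ α : ℕ → ℕ → Ω → ℝ)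
    (w : ℕ → ℕ → Ω → Plane) (Ωstar : Matrix (Fin 2) (Fin 2) ℝ) : Prop where
  measurable_shock : ∀ i t, Measurable (w i t)
  /-- Independence across individuals, of the shocks together with initial value and drift. -/
  indep : ∀ T, iIndepFun (fun i ω => (δ₀ T i ω, α T i ω, fun t => w i (t + 1) ω)) μ
  /-- The shock sequences of all individuals have the same law. -/
  identDistrib : ∀ i j,
    IdentDistrib (fun ω (t : ℕ) => w i (t + 1) ω) (fun ω (t : ℕ) => w j (t + 1) ω) μ μ
  /-- Strict stationarity and ergodicity: the law of the shock sequence of an individual is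
  invariant and ergodic under the shift. -/
  ergodic : ∀ i, Ergodic (fun (s : ℕ → Plane) (t : ℕ) => s (t + 1))
    (μ.map fun ω (t : ℕ) => w i (t + 1) ω)
  fourth_moment : ∃ C : ℝ, ∀ i t, 1 ≤ t →
    Integrable (fun ω => ‖w i t ω‖ ^ 4) μ ∧ ∫ ω, ‖w i t ω‖ ^ 4 ∂μ < C
  martingale_diff : ∀ T i t, μ[w i (t + 1) | past (δ₀ T i) (α T i) (w i) t] =ᵐ[μ] 0
  posDef : Ωstar.PosDef
  cond_cov : ∀ T i t (a b : Fin 2),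
    μ[fun ω => w i (t + 1) ω a * w i (t + 1) ω b | past (δ₀ T i) (α T i) (w i) t]
      =ᵐ[μ] fun _ => Ωstar a b

/-- `Z = O_p(r)` along the filter `l`. -/
def IsBigOp {Ω : Type*} [MeasurableSpace Ω] {ι : Type*} (μ : Measure Ω) (l : Filter ι)
    (Z : ι → Ω → ℝ) (r : ι → ℝ) : Prop :=
  ∀ ε : ℝ, 0 < ε → ∃ M : ℝ, ∀ᶠ p in l, μ.real {ω | M * r p < |Z p ω|} ≤ ε

/-- Joint asymptotics `(n, T) → ∞` without restriction on the relative rates, `T` even. -/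
def jointLimit : Filter (ℕ × ℕ) := atTop ×ˢ (atTop ⊓ 𝓟 {T | Even T})

end XJ

/-!
Let `δ` be the state, `x = α + δ`, and `T = 2 m + 2`, so that each of the two index sets has `m`
elements. Since `x (t + 1) = α (1 - ρ) + ρ x t + v (t + 1)` and demeaning removes constants, the
contribution of one individual to `numer - ρ * denom` (its `score`) is, by `numer_sub_denom`, a
martingale sum `∑ δ t * v (t + 1)`, minus the products `m⁻¹ (∑ δ) (∑ v)` that come from demeaning,
plus the bias correction. Three facts about one individual, uniform over individuals and over large
even `T`, carry the proof.

* The score is nearly centred. Demeaning within every second period has a bias that is explicit in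
  the impulse responses `ρ ^ k`, and the correction reproduces it up to one geometric sum: drift and
  initial value cancel, and `integral_score` gives the mean
  `-(σ² / m) ∑_{j < m - 1} ρ ^ (2 j + 1) = O(T ^ (γ - 1))`.
* The score has second moment `O(T ^ (1 + γ))` (`integral_score_sq_le`). The martingale sum has
  orthogonal increments; all remaining terms are bounded crudely by fourth moments, using
  `E δ_t⁴ = O(T ^ (2 γ))`, which follows from a recursion in `t`
  (`integral_add_shock_pow_four_le`), so that no maximal or Burkholder inequality is needed.
* The denominator `info` has mean of exact order `T ^ (1 + γ)` and second moment
  `O(T ^ (2 + 2 γ))`. The lower bound `le_integral_info` writes the within-group sum of squares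
  through pairwise differences, each of which has at least the variance of the shocks in between.

The growth in `T` enters only through `|ρ| ^ t` and `∑_{j < T} ρ ^ (2 j)`, which
`Admissible.exists_upper_bounds` and `Admissible.exists_lower_bound` bound in all three regimes.
Chebyshev's inequality for sums over independent individuals (`measureReal_ratio_le`) then gives
numerator `O_p(√(n T ^ (1 + γ)) + n T ^ (γ - 1))` and denominator at least a multiple of
`n T ^ (1 + γ)`, whose ratio is the claim. The only law of large numbers used is the one across
individuals; it comes from second moments, with no ergodic theorem along time.
-/

open MeasureTheory ProbabilityTheory Filter Topology

namespace XJ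

/-! ### The estimator in terms of states and shocks -/

theorem sum_evenIdx (m : ℕ) (f : ℕ → ℝ) :
    ∑ t ∈ evenIdx (2 * m + 2), f t = ∑ a ∈ Finset.range m, f (2 * a + 2) := by
  have h : evenIdx (2 * m + 2) = (Finset.range m).image (fun a => 2 * a + 2) := by
    ext t
    simp only [evenIdx, Finset.mem_filter, Finset.mem_Icc, Finset.mem_image, Finset.mem_range]
    constructor
    · rintro ⟨⟨h1, h2⟩, r, hr⟩
      exact ⟨r - 1, by omega, by omega⟩
    · rintro ⟨a, ha, rfl⟩
      exact ⟨by omega, ⟨a + 1, by omega⟩⟩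
  rw [h, Finset.sum_image]
  intro a _ b _ hab
  simp only at hab
  omega

theorem sum_oddIdx (m : ℕ) (f : ℕ → ℝ) :
    ∑ t ∈ oddIdx (2 * m + 2), f t = ∑ a ∈ Finset.range m, f (2 * a + 3) := by
  have h : oddIdx (2 * m + 2) = (Finset.range m).image (fun a => 2 * a + 3) := by
    ext t
    simp only [oddIdx, Finset.mem_filter, Finset.mem_Icc, Finset.mem_image, Finset.mem_range]
    constructor
    · rintro ⟨⟨h1, h2⟩, r, hr⟩
      exact ⟨r - 1, by omega, by omega⟩
    · rintro ⟨a, ha, rfl⟩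
      exact ⟨by omega, ⟨a + 1, by omega⟩⟩
  rw [h, Finset.sum_image]
  intro a _ b _ hab
  simp only at hab
  omega

/-- The within-group sum of squares of `x 0, …, x (m - 1)`. -/
noncomputable def sumSq (m : ℕ) (x : ℕ → ℝ) : ℝ :=
  ∑ a ∈ Finset.range m, (x a - 1 / (m : ℝ) * ∑ b ∈ Finset.range m, x b) ^ 2

theorem sumSq_eq (m : ℕ) (hm : 0 < m) (x : ℕ → ℝ) :
    sumSq m x = ∑ a ∈ Finset.range m, x a ^ 2
      - 1 / (m : ℝ) * (∑ a ∈ Finset.range m, x a) ^ 2 := by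
  have hm' : (m : ℝ) ≠ 0 := by positivity
  simp only [sumSq, sub_sq, Finset.sum_add_distrib, Finset.sum_sub_distrib, Finset.sum_const,
    Finset.card_range, nsmul_eq_mul, ← Finset.sum_mul, ← Finset.mul_sum]
  field_simp
  ring

theorem sumSq_eq_pairs (m : ℕ) (hm : 0 < m) (x : ℕ → ℝ) :
    sumSq m x = 1 / (2 * (m : ℝ)) *
      ∑ a ∈ Finset.range m, ∑ b ∈ Finset.range m, (x a - x b) ^ 2 := by
  have hm' : (m : ℝ) ≠ 0 := by positivity
  rw [sumSq_eq m hm]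
  simp only [sub_sq, Finset.sum_add_distrib, Finset.sum_sub_distrib, Finset.sum_const,
    Finset.card_range, nsmul_eq_mul, ← Finset.sum_mul, ← Finset.mul_sum]
  field_simp
  ring

theorem sumSq_add_const (m : ℕ) (hm : 0 < m) (x : ℕ → ℝ) (r : ℝ) :
    sumSq m (fun a => r + x a) = sumSq m x := by
  simp [sumSq_eq_pairs m hm]

theorem sumSq_nonneg (m : ℕ) (x : ℕ → ℝ) : 0 ≤ sumSq m x :=
  Finset.sum_nonneg fun _ _ => sq_nonneg _

theorem sumSq_le (m : ℕ) (hm : 0 < m) (x : ℕ → ℝ) :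
    sumSq m x ≤ ∑ a ∈ Finset.range m, x a ^ 2 := by
  rw [sumSq_eq m hm]
  have : 0 ≤ 1 / (m : ℝ) * (∑ a ∈ Finset.range m, x a) ^ 2 := by positivity
  linarith

/-- The product sum of demeaned `x` with `k + ρ x + v`: the constant drops out, and the shock enters
through its own product sum and through a product of two sums that is due to demeaning. -/
theorem sum_demean_mul (m : ℕ) (hm : 0 < m) (x v : ℕ → ℝ) (k ρ : ℝ) :
    ∑ a ∈ Finset.range m,
        (x a - 1 / (m : ℝ) * ∑ b ∈ Finset.range m, x b) * (k + ρ * x a + v a)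
      = ρ * sumSq m x + ∑ a ∈ Finset.range m, x a * v a
        - 1 / (m : ℝ) * ((∑ a ∈ Finset.range m, x a) * ∑ a ∈ Finset.range m, v a) := by
  have hm' : (m : ℝ) ≠ 0 := by positivity
  rw [sumSq_eq m hm]
  have : ∀ a, (x a - 1 / (m : ℝ) * ∑ b ∈ Finset.range m, x b) * (k + ρ * x a + v a)
      = k * x a + ρ * x a ^ 2 + x a * v a - (1 / (m : ℝ) * ∑ b ∈ Finset.range m, x b) * k
       - (1 / (m : ℝ) * ∑ b ∈ Finset.range m, x b) * ρ * x a
       - (1 / (m : ℝ) * ∑ b ∈ Finset.range m, x b) * v a := fun a => by ring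
  simp only [this, Finset.sum_add_distrib, Finset.sum_sub_distrib, Finset.sum_const,
    Finset.card_range, nsmul_eq_mul, ← Finset.mul_sum]
  field_simp
  ring

theorem denom_eq (m : ℕ) (x : ℕ → ℝ) :
    denom (2 * m + 2) x
      = sumSq m (fun a => x (2 * a + 3)) + sumSq m (fun a => x (2 * a + 2)) := by
  have h : (2 : ℝ) / (((2 * m + 2 : ℕ) : ℝ) - 2) = 1 / m := by
    push_cast
    rw [add_sub_cancel_right, ← div_div, div_self two_ne_zero]
  simp only [denom, demean, sum_oddIdx, sum_evenIdx, sumSq, h]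

theorem denom_observable (m : ℕ) (hm : 0 < m) (ρ α δ₀ : ℝ) (v : ℕ → ℝ) :
    denom (2 * m + 2) (observable ρ α δ₀ v)
      = sumSq m (fun a => state ρ δ₀ v (2 * a + 3))
        + sumSq m (fun a => state ρ δ₀ v (2 * a + 2)) := by
  rw [denom_eq]
  simp only [observable]
  rw [sumSq_add_const m hm (fun a => state ρ δ₀ v (2 * a + 3)),
    sumSq_add_const m hm (fun a => state ρ δ₀ v (2 * a + 2))]

/-- The estimation error of one individual, `numer - ρ * denom`, in terms of the states and the
shocks: the drift is removed from the within-group terms, and the remaining terms are the bias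
correction. -/
theorem numer_sub_denom (m : ℕ) (hm : 0 < m) (ρ α δ₀ : ℝ) (v : ℕ → ℝ) :
    numer (2 * m + 2) (observable ρ α δ₀ v) - ρ * denom (2 * m + 2) (observable ρ α δ₀ v)
      = ∑ a ∈ Finset.range m, state ρ δ₀ v (2 * a + 3) * v (2 * a + 4)
        + ∑ a ∈ Finset.range m, state ρ δ₀ v (2 * a + 2) * v (2 * a + 3)
        - 1 / (m : ℝ) * ((∑ a ∈ Finset.range m, state ρ δ₀ v (2 * a + 3))
            * ∑ a ∈ Finset.range m, v (2 * a + 4))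
        - 1 / (m : ℝ) * ((∑ a ∈ Finset.range m, state ρ δ₀ v (2 * a + 2))
            * ∑ a ∈ Finset.range m, v (2 * a + 3))
        + 1 / (m : ℝ) * ∑ a ∈ Finset.range m,
            (2 * (observable ρ α δ₀ v (a + 1) * observable ρ α δ₀ v (a + 2))
              - observable ρ α δ₀ v 1 * observable ρ α δ₀ v (2 * a + 2)
              - observable ρ α δ₀ v 2 * observable ρ α δ₀ v (2 * a + 1)) := by
  have hm' : (m : ℝ) ≠ 0 := by positivity
  have h2 : (2 : ℝ) / (((2 * m + 2 : ℕ) : ℝ) - 2) = 1 / m := by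
    push_cast
    rw [add_sub_cancel_right, ← div_div, div_self two_ne_zero]
  have h4 : (4 : ℝ) / (((2 * m + 2 : ℕ) : ℝ) - 2) = 2 * (1 / m) := by
    rw [← h2]; ring
  have hIcc : ∀ f : ℕ → ℝ, ∑ t ∈ Finset.Icc 1 ((2 * m + 2 - 2) / 2), f t
      = ∑ a ∈ Finset.range m, f (a + 1) := by
    intro f
    have : (2 * m + 2 - 2) / 2 = m := by omega
    rw [this, Finset.range_eq_Ico, Finset.sum_Ico_add' f 0 m 1]
    rfl
  have hstep : ∀ t, observable ρ α δ₀ v (t + 1)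
      = α * (1 - ρ) + ρ * observable ρ α δ₀ v t + v (t + 1) := by
    intro t
    simp only [observable, state]
    ring
  have hd : ∀ (x u : ℕ → ℝ), ∑ a ∈ Finset.range m, (α + x a) * u a
      - 1 / (m : ℝ) * ((∑ a ∈ Finset.range m, (α + x a)) * ∑ a ∈ Finset.range m, u a)
      = ∑ a ∈ Finset.range m, x a * u a
      - 1 / (m : ℝ) * ((∑ a ∈ Finset.range m, x a) * ∑ a ∈ Finset.range m, u a) := by
    intro x u
    simp only [add_mul, Finset.sum_add_distrib, Finset.sum_const, Finset.card_range,
      nsmul_eq_mul, ← Finset.mul_sum]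
    field_simp
    ring
  have hodd := sum_demean_mul m hm (fun a => observable ρ α δ₀ v (2 * a + 3))
    (fun a => v (2 * a + 4)) (α * (1 - ρ)) ρ
  have heven := sum_demean_mul m hm (fun a => observable ρ α δ₀ v (2 * a + 2))
    (fun a => v (2 * a + 3)) (α * (1 - ρ)) ρ
  have hdo := hd (fun a => state ρ δ₀ v (2 * a + 3)) (fun a => v (2 * a + 4))
  have hde := hd (fun a => state ρ δ₀ v (2 * a + 2)) (fun a => v (2 * a + 3))
  have ho : ∀ a, observable ρ α δ₀ v (2 * a + 3 + 1)
      = α * (1 - ρ) + ρ * observable ρ α δ₀ v (2 * a + 3) + v (2 * a + 4) := fun a => hstep _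
  have he : ∀ a, observable ρ α δ₀ v (2 * a + 2 + 1)
      = α * (1 - ρ) + ρ * observable ρ α δ₀ v (2 * a + 2) + v (2 * a + 3) := fun a => hstep _
  simp only [← ho] at hodd
  simp only [← he] at heven
  have hs : ∀ a, 2 * a + 3 - 2 = 2 * a + 1 := fun a => by omega
  rw [denom_eq]
  simp only [numer, eta, demean, sum_oddIdx, sum_evenIdx, h2, h4, hIcc, hs,
    Finset.sum_sub_distrib, ← Finset.mul_sum]
  rw [hodd, heven]
  simp only [observable] at hdo hde ⊢
  linear_combination hdo + hde

/-! ### Order of the impulse responses -/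

theorem sum_pow_two_mul_le_of_lt_one {ρ : ℝ} (h : ρ ^ 2 < 1) (k : ℕ) :
    ∑ j ∈ Finset.range k, ρ ^ (2 * j) ≤ 1 / (1 - ρ ^ 2) := by
  simp only [pow_mul]
  rw [geom_sum_eq h.ne, ← neg_sub, ← neg_sub 1, neg_div_neg_eq]
  have h1 : 0 < 1 - ρ ^ 2 := by linarith
  gcongr
  have : 0 ≤ (ρ ^ 2) ^ k := by positivity
  linarith

theorem Admissible.mem_Icc {c γ : ℝ} (h : Admissible c γ) : 0 ≤ γ ∧ γ ≤ 1 := by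
  rcases h with ⟨rfl, _⟩ | ⟨h1, h2, _⟩ | rfl
  · simp
  · exact ⟨h1.le, h2.le⟩
  · simp

/-- Powers of `ρ*_T` up to the sample length are bounded, and the sums of squared impulse
responses are at most of order `T ^ γ`. -/
theorem Admissible.exists_upper_bounds {c γ : ℝ} (h : Admissible c γ) :
    ∃ K : ℝ, 1 ≤ K ∧ ∀ᶠ T : ℕ in atTop,
      (∀ t ≤ T, rhoStar c γ T ^ (2 * t) ≤ K) ∧
      ∑ j ∈ Finset.range T, rhoStar c γ T ^ (2 * j) ≤ K * (T : ℝ) ^ γ := by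
  rcases h with ⟨rfl, h1, h2⟩ | ⟨h1, h2, h3⟩ | rfl
  · have hρ : (1 + c) ^ 2 < 1 := by nlinarith
    have hp : 0 < 1 - (1 + c) ^ 2 := by linarith
    refine ⟨1 / (1 - (1 + c) ^ 2), ?_, Eventually.of_forall fun T => ?_⟩
    · rw [le_div_iff₀ hp]; nlinarith [sq_nonneg (1 + c)]
    · have hK : 1 ≤ 1 / (1 - (1 + c) ^ 2) := by
        rw [le_div_iff₀ hp]; nlinarith [sq_nonneg (1 + c)]
      simp only [rhoStar, Real.rpow_zero, div_one, mul_one]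
      refine ⟨fun t _ => ?_, sum_pow_two_mul_le_of_lt_one hρ T⟩
      rw [pow_mul]
      exact (pow_le_one₀ (sq_nonneg _) hρ.le).trans hK
  · have hT : Tendsto (fun T : ℕ => (T : ℝ) ^ γ) atTop atTop :=
      (tendsto_rpow_atTop h1).comp tendsto_natCast_atTop_atTop
    refine ⟨max 1 (1 / -c), le_max_left _ _, ?_⟩
    filter_upwards [hT.eventually_ge_atTop (max 1 (-c))] with T hTc
    set B := (T : ℝ) ^ γ
    have hB : 0 < B := lt_of_lt_of_le one_pos ((le_max_left _ _).trans hTc)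
    have hBc : -c ≤ B := (le_max_right _ _).trans hTc
    have hx0 : 0 < -c / B := div_pos (by linarith) hB
    have hx1 : -c / B ≤ 1 := (div_le_one hB).2 hBc
    have hρ : rhoStar c γ T = 1 - -c / B := by simp only [rhoStar, B]; ring
    have hsq : rhoStar c γ T ^ 2 < 1 := by rw [hρ]; nlinarith
    refine ⟨fun t _ => ?_, (sum_pow_two_mul_le_of_lt_one hsq T).trans ?_⟩
    · rw [pow_mul]
      exact (pow_le_one₀ (sq_nonneg _) hsq.le).trans (le_max_left _ _)
    · calc 1 / (1 - rhoStar c γ T ^ 2) ≤ 1 / (-c / B) := by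
            gcongr
            rw [hρ]; nlinarith
        _ = 1 / -c * B := by rw [one_div_div]; ring
        _ ≤ _ := by gcongr; exact le_max_right _ _
  · have hpow : ∀ T : ℕ, 1 ≤ T → ∀ t ≤ T, rhoStar c 1 T ^ (2 * t) ≤ Real.exp (2 * |c|) := by
      intro T hT t ht
      have hT' : (0 : ℝ) < T := by exact_mod_cast hT
      have h1 : |rhoStar c 1 T| ≤ Real.exp (|c| / T) := by
        have := Real.add_one_le_exp (|c| / T)
        calc |rhoStar c 1 T| ≤ |1| + |c / T| := by
              simp only [rhoStar, Real.rpow_one]; exact abs_add_le _ _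
          _ = |c| / T + 1 := by rw [abs_div, abs_one, abs_of_pos hT']; ring
          _ ≤ _ := this
      calc rhoStar c 1 T ^ (2 * t) = |rhoStar c 1 T| ^ (2 * t) := by
            rw [pow_mul, pow_mul, sq_abs]
        _ ≤ Real.exp (|c| / T) ^ (2 * t) := by gcongr
        _ = Real.exp (((2 * t : ℕ) : ℝ) * (|c| / T)) := by rw [Real.exp_nat_mul]
        _ ≤ Real.exp (2 * |c|) := by
            apply Real.exp_le_exp.2
            have : (t : ℝ) ≤ T := by exact_mod_cast ht
            have h3 : (t : ℝ) * (|c| / T) ≤ T * (|c| / T) := by gcongr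
            rw [mul_div_cancel₀ _ hT'.ne'] at h3
            push_cast
            linarith
    refine ⟨Real.exp (2 * |c|), Real.one_le_exp (by positivity), ?_⟩
    filter_upwards [eventually_ge_atTop 1] with T hT
    refine ⟨hpow T hT, ?_⟩
    calc ∑ j ∈ Finset.range T, rhoStar c 1 T ^ (2 * j)
        ≤ ∑ j ∈ Finset.range T, Real.exp (2 * |c|) :=
          Finset.sum_le_sum fun j hj => hpow T hT j (Finset.mem_range.1 hj).le
      _ = _ := by simp [mul_comm]

/-- Over a fixed fraction of the sample, the sum of squared impulse responses is at least of
order `T ^ γ`. -/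
theorem Admissible.exists_lower_bound {c γ : ℝ} (h : Admissible c γ) :
    ∃ κ : ℝ, 0 < κ ∧ ∀ᶠ T : ℕ in atTop, ∀ k : ℕ, T ≤ 12 * k →
      κ * (T : ℝ) ^ γ ≤ ∑ j ∈ Finset.range k, rhoStar c γ T ^ (2 * j) := by
  obtain ⟨hγ0, hγ1⟩ := h.mem_Icc
  rcases hγ0.eq_or_lt with rfl | hγ
  · refine ⟨1, one_pos, ?_⟩
    filter_upwards [eventually_ge_atTop 1] with T hT k hk
    have hk0 : 0 ∈ Finset.range k := Finset.mem_range.2 (by omega)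
    have := Finset.single_le_sum (f := fun j => rhoStar c 0 T ^ (2 * j))
      (fun j _ => by rw [pow_mul]; positivity) hk0
    simpa using this
  · have hT : Tendsto (fun T : ℕ => (T : ℝ) ^ γ) atTop atTop :=
      (tendsto_rpow_atTop hγ).comp tendsto_natCast_atTop_atTop
    refine ⟨1 / (48 * (|c| + 1)), by positivity, ?_⟩
    filter_upwards [hT.eventually_ge_atTop (max 1 |c|), eventually_ge_atTop 1] with T hTc hT1 k hk
    have hTT : (T : ℝ) ^ γ ≤ T := by
      have h1 : (1 : ℝ) ≤ T := by exact_mod_cast hT1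
      simpa using Real.rpow_le_rpow_of_exponent_le h1 hγ1
    set B := (T : ℝ) ^ γ
    have hB : 0 < B := lt_of_lt_of_le one_pos ((le_max_left _ _).trans hTc)
    have hx1 : |c| / B ≤ 1 := (div_le_one hB).2 ((le_max_right _ _).trans hTc)
    have hρ : 1 - |c| / B ≤ rhoStar c γ T := by
      have h1 : -(|c| / B) ≤ c / B := by
        rw [← neg_div]; gcongr; exact neg_abs_le c
      simp only [rhoStar]
      linarith
    -- By Bernoulli's inequality, squared impulse responses up to the lag `T ^ γ / (24 (|c| + 1))`
    -- stay above `1 / 2`.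
    have hlow : ∀ j : ℕ, (j : ℝ) ≤ B / (24 * (|c| + 1)) → 1 / 2 ≤ rhoStar c γ T ^ (2 * j) := by
      intro j hj
      have h1 := one_add_mul_le_pow (a := -(|c| / B)) (by linarith) (2 * j)
      have h2 : (j : ℝ) * (|c| / B) ≤ 1 / 24 := by
        calc (j : ℝ) * (|c| / B) ≤ B / (24 * (|c| + 1)) * (|c| / B) := by gcongr
          _ = |c| / (|c| + 1) / 24 := by field_simp
          _ ≤ 1 / 24 := by
            gcongr
            exact (div_le_one (by positivity)).2 (by linarith)
      calc (1 : ℝ) / 2 ≤ 1 + ((2 * j : ℕ) : ℝ) * -(|c| / B) := by push_cast; linarith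
        _ ≤ (1 + -(|c| / B)) ^ (2 * j) := h1
        _ ≤ _ := by
          have : 0 ≤ 1 + -(|c| / B) := by linarith
          gcongr
          linarith
    set k' := ⌈B / (24 * (|c| + 1))⌉₊
    have hk' : k' ≤ k := by
      apply Nat.ceil_le.2
      have h1 : (T : ℝ) ≤ 12 * k := by exact_mod_cast hk
      rw [div_le_iff₀ (by positivity)]
      nlinarith [abs_nonneg c, (Nat.cast_nonneg k : (0 : ℝ) ≤ k)]
    calc 1 / (48 * (|c| + 1)) * B = B / (24 * (|c| + 1)) * (1 / 2) := by field_simp; norm_num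
      _ ≤ k' * (1 / 2) := by gcongr; exact Nat.le_ceil _
      _ = ∑ j ∈ Finset.range k', (1 / 2 : ℝ) := by simp
      _ ≤ ∑ j ∈ Finset.range k', rhoStar c γ T ^ (2 * j) := by
        refine Finset.sum_le_sum fun j hj => hlow j ?_
        exact (Nat.lt_ceil.1 (Finset.mem_range.1 hj)).le
      _ ≤ _ := by
        refine Finset.sum_le_sum_of_subset_of_nonneg (Finset.range_mono hk') fun j _ _ => ?_
        rw [pow_mul]; positivity

/-- The bound allowed for the fourth moments of initial value and drift is at most of order
`T ^ (2 γ)`. For `c = 0` the first entry of the minimum is infinite, but then `γ = 1`, and the second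
is `T ^ 2`. -/
theorem Admissible.exists_invMin_le {c γ : ℝ} (h : Admissible c γ) :
    ∃ K : ℝ, 0 ≤ K ∧ ∀ T : ℕ, 1 ≤ T →
      0 ≤ invMin (|1 - rhoStar c γ T| ^ 2) ((T : ℝ) ^ 2) ∧
      invMin (|1 - rhoStar c γ T| ^ 2) ((T : ℝ) ^ 2) ≤ K * ((T : ℝ) ^ γ) ^ 2 := by
  refine ⟨max 1 (1 / c ^ 2), by positivity, fun T hT => ?_⟩
  have hT' : (0 : ℝ) < T := by exact_mod_cast hT
  have hB : 0 < (T : ℝ) ^ γ := by positivity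
  have hd : |1 - rhoStar c γ T| ^ 2 = c ^ 2 / ((T : ℝ) ^ γ) ^ 2 := by
    rw [sq_abs]; simp only [rhoStar]; ring
  rw [hd]
  unfold invMin
  split_ifs with h0
  · have hc : c = 0 := by
      rcases div_eq_zero_iff.1 h0 with h1 | h1
      · exact pow_eq_zero_iff two_ne_zero |>.1 h1
      · exact absurd h1 (by positivity)
    have hγ : γ = 1 := by
      rcases h with ⟨_, _, h3⟩ | ⟨_, _, h3⟩ | h3
      · linarith
      · linarith
      · exact h3
    subst hγ
    refine ⟨by positivity, ?_⟩
    rw [Real.rpow_one]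
    have := le_max_left 1 (1 / c ^ 2)
    nlinarith [sq_nonneg (T : ℝ)]
  · refine ⟨by positivity, (min_le_left _ _).trans ?_⟩
    rw [inv_div]
    calc ((T : ℝ) ^ γ) ^ 2 / c ^ 2 = 1 / c ^ 2 * ((T : ℝ) ^ γ) ^ 2 := by ring
      _ ≤ _ := by gcongr; exact le_max_right _ _

/-! ### Products of variables in `L⁴` -/

section Lp

variable {Ω : Type*} [MeasurableSpace Ω] {μ : Measure Ω} {f g : Ω → ℝ}

theorem memLp_two_mul (hf : MemLp f 4 μ) (hg : MemLp g 4 μ) :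
    MemLp (fun ω => f ω * g ω) 2 μ := by
  have : ENNReal.HolderTriple 4 4 2 := ⟨by
    have h4 : (4 : ENNReal) = 2 * 2 := by norm_num
    rw [h4, ENNReal.mul_inv (by simp) (by simp), ← mul_add, ENNReal.inv_two_add_inv_two, mul_one]⟩
  exact hg.mul (p := 4) (q := 4) (r := 2) hf

theorem integrable_mul_of_memLp_two (hf : MemLp f 2 μ) (hg : MemLp g 2 μ) :
    Integrable (fun ω => f ω * g ω) μ :=
  MemLp.integrable_mul hf hg

theorem integrable_pow_four (hf : MemLp f 4 μ) : Integrable (fun ω => f ω ^ 4) μ := by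
  have := integrable_mul_of_memLp_two (memLp_two_mul hf hf) (memLp_two_mul hf hf)
  refine this.congr (Eventually.of_forall fun ω => ?_)
  simp only
  ring

theorem integrable_mul_sq (hf : MemLp f 4 μ) (hg : MemLp g 4 μ) :
    Integrable (fun ω => (f ω * g ω) ^ 2) μ :=
  (memLp_two_mul hf hg).integrable_sq

theorem integral_add_pow_four_le (hf : MemLp f 4 μ) (hg : MemLp g 4 μ) :
    ∫ ω, (f ω + g ω) ^ 4 ∂μ ≤ 8 * (∫ ω, f ω ^ 4 ∂μ + ∫ ω, g ω ^ 4 ∂μ) := by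
  rw [← integral_add (integrable_pow_four hf) (integrable_pow_four hg), ← integral_const_mul]
  refine integral_mono (integrable_pow_four (hf.add hg))
    (((integrable_pow_four hf).add (integrable_pow_four hg)).const_mul 8) fun ω => ?_
  simp only
  nlinarith [sq_nonneg (f ω - g ω), sq_nonneg (f ω ^ 2 - g ω ^ 2), sq_nonneg (f ω + g ω),
    sq_nonneg ((f ω - g ω) ^ 2), sq_nonneg (f ω * (f ω - g ω)), sq_nonneg (g ω * (f ω - g ω)),
    sq_nonneg ((f ω - g ω) * (f ω + g ω))]

theorem integral_average_sq_le {m : ℕ} (hm : 0 < m) {F : ℕ → Ω → ℝ} {b : ℝ}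
    (hF : ∀ a < m, MemLp (F a) 2 μ) (hb : ∀ a < m, ∫ ω, F a ω ^ 2 ∂μ ≤ b) :
    ∫ ω, (1 / (m : ℝ) * ∑ a ∈ Finset.range m, F a ω) ^ 2 ∂μ ≤ b := by
  have hm' : (0 : ℝ) < m := by exact_mod_cast hm
  have hF' : ∀ a ∈ Finset.range m, MemLp (F a) 2 μ := fun a ha => hF a (Finset.mem_range.1 ha)
  have hi : ∀ a ∈ Finset.range m, Integrable (fun ω => F a ω ^ 2) μ :=
    fun a ha => (hF' a ha).integrable_sq
  calc ∫ ω, (1 / (m : ℝ) * ∑ a ∈ Finset.range m, F a ω) ^ 2 ∂μ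
      ≤ ∫ ω, 1 / (m : ℝ) * ∑ a ∈ Finset.range m, F a ω ^ 2 ∂μ := by
        refine integral_mono ((memLp_finsetSum _ hF').const_mul _).integrable_sq
          ((integrable_finsetSum _ hi).const_mul _) fun ω => ?_
        simp only
        have h1 : (∑ a ∈ Finset.range m, F a ω) ^ 2 ≤ m * ∑ a ∈ Finset.range m, F a ω ^ 2 := by
          simpa using sq_sum_le_card_mul_sum_sq (s := Finset.range m) (f := fun a => F a ω)
        calc (1 / (m : ℝ) * ∑ a ∈ Finset.range m, F a ω) ^ 2
            = 1 / (m : ℝ) ^ 2 * (∑ a ∈ Finset.range m, F a ω) ^ 2 := by ring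
          _ ≤ 1 / (m : ℝ) ^ 2 * (m * ∑ a ∈ Finset.range m, F a ω ^ 2) := by gcongr
          _ = _ := by field_simp
    _ = 1 / (m : ℝ) * ∑ a ∈ Finset.range m, ∫ ω, F a ω ^ 2 ∂μ := by
        rw [integral_const_mul, integral_finsetSum _ hi]
    _ ≤ 1 / (m : ℝ) * ∑ a ∈ Finset.range m, b := by
        gcongr with a ha
        exact hb a (Finset.mem_range.1 ha)
    _ = b := by simp; field_simp

/-- Young's inequality; the weight `r` serves to balance fourth moments of different orders. -/
theorem integral_mul_sq_le (hf : MemLp f 4 μ) (hg : MemLp g 4 μ) {r : ℝ} (hr : 0 < r) :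
    ∫ ω, (f ω * g ω) ^ 2 ∂μ ≤ (r * ∫ ω, f ω ^ 4 ∂μ + 1 / r * ∫ ω, g ω ^ 4 ∂μ) / 2 := by
  have h1 := (integrable_pow_four hf).const_mul r
  have h2 := (integrable_pow_four hg).const_mul (1 / r)
  rw [← integral_const_mul, ← integral_const_mul, ← integral_add h1 h2, ← integral_div]
  refine integral_mono (integrable_mul_sq hf hg) ((h1.add h2).div_const 2) fun ω => ?_
  simp only
  rw [le_div_iff₀ two_pos]
  have h3 : r * f ω ^ 4 + 1 / r * g ω ^ 4 - (f ω * g ω) ^ 2 * 2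
      = 1 / r * (r * f ω ^ 2 - g ω ^ 2) ^ 2 := by field_simp; ring
  have h4 : 0 ≤ 1 / r * (r * f ω ^ 2 - g ω ^ 2) ^ 2 := by positivity
  linarith

variable [IsProbabilityMeasure μ]

theorem memLp_two_of_four (hf : MemLp f 4 μ) : MemLp f 2 μ :=
  hf.mono_exponent (by norm_num)

theorem integrable_mul_of_memLp_four (hf : MemLp f 4 μ) (hg : MemLp g 4 μ) :
    Integrable (fun ω => f ω * g ω) μ :=
  integrable_mul_of_memLp_two (memLp_two_of_four hf) (memLp_two_of_four hg)

theorem integrable_sq_of_memLp_four (hf : MemLp f 4 μ) : Integrable (fun ω => f ω ^ 2) μ :=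
  (memLp_two_of_four hf).integrable_sq

end Lp

/-! ### One individual -/

/-- The probabilistic content of the assumptions on one individual at a fixed sample length:
initial value and drift are known at time `0` and uncorrelated, and the shocks `v 1, v 2, …` are
martingale differences with constant conditional variance `s`. All variables are in `L⁴`. -/
structure IsIndividual {Ω : Type*} [m0 : MeasurableSpace Ω] (μ : Measure Ω)
    (ℱ : Filtration ℕ m0) (δ₀ α : Ω → ℝ) (v : ℕ → Ω → ℝ) (s C : ℝ) : Prop where
  measurable_init : Measurable[ℱ 0] δ₀
  measurable_drift : Measurable[ℱ 0] α
  memLp_init : MemLp δ₀ 4 μ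
  memLp_drift : MemLp α 4 μ
  uncorrelated : ∫ ω, α ω * δ₀ ω ∂μ = 0
  measurable_shock : ∀ t, Measurable[ℱ (t + 1)] (v (t + 1))
  memLp_shock : ∀ t, MemLp (v (t + 1)) 4 μ
  fourth_moment_shock : ∀ t, ∫ ω, v (t + 1) ω ^ 4 ∂μ ≤ C
  condExp_shock : ∀ t, μ[v (t + 1) | ℱ t] =ᵐ[μ] 0
  condExp_shock_sq : ∀ t, μ[fun ω => v (t + 1) ω ^ 2 | ℱ t] =ᵐ[μ] fun _ => s

namespace IsIndividual

variable {Ω : Type*} [m0 : MeasurableSpace Ω] {μ : Measure Ω}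
  {ℱ : Filtration ℕ m0} {δ₀ α : Ω → ℝ} {v : ℕ → Ω → ℝ} {s C ρ : ℝ}

theorem fourth_moment_nonneg (h : IsIndividual μ ℱ δ₀ α v s C) : 0 ≤ C :=
  (integral_nonneg fun ω => by positivity).trans (h.fourth_moment_shock 0)

/-- The state of the individual at time `t`, as a random variable. -/
abbrev path (ρ : ℝ) (δ₀ : Ω → ℝ) (v : ℕ → Ω → ℝ) (t : ℕ) (ω : Ω) : ℝ :=
  state ρ (δ₀ ω) (fun t => v t ω) t

theorem measurable_path (h : IsIndividual μ ℱ δ₀ α v s C) (ρ : ℝ) (t : ℕ) :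
    Measurable[ℱ t] (path ρ δ₀ v t) := by
  induction t with
  | zero => exact h.measurable_init
  | succ t ih =>
    exact ((ih.mono (ℱ.mono t.le_succ) le_rfl).const_mul ρ).add (h.measurable_shock t)

theorem memLp_path (h : IsIndividual μ ℱ δ₀ α v s C) (ρ : ℝ) (t : ℕ) :
    MemLp (path ρ δ₀ v t) 4 μ := by
  induction t with
  | zero => exact h.memLp_init
  | succ t ih => exact (ih.const_mul ρ).add (h.memLp_shock t)

variable [IsProbabilityMeasure μ]

theorem integral_mul_shock (h : IsIndividual μ ℱ δ₀ α v s C) {t : ℕ} {X : Ω → ℝ}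
    (hX : Measurable[ℱ t] X) (hi : Integrable (fun ω => X ω * v (t + 1) ω) μ) :
    ∫ ω, X ω * v (t + 1) ω ∂μ = 0 := by
  have hv : Integrable (v (t + 1)) μ := (h.memLp_shock t).integrable (by norm_num)
  have h1 := condExp_mul_of_stronglyMeasurable_left (m := ℱ t) hX.stronglyMeasurable hi hv
  rw [← integral_condExp (ℱ.le t)]
  refine integral_eq_zero_of_ae ?_
  filter_upwards [h1, h.condExp_shock t] with ω h2 h3
  refine h2.trans ?_
  simp [h3]

theorem integral_mul_shock_sq (h : IsIndividual μ ℱ δ₀ α v s C) {t : ℕ} {X : Ω → ℝ}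
    (hX : Measurable[ℱ t] X) (hi : Integrable (fun ω => X ω * v (t + 1) ω ^ 2) μ) :
    ∫ ω, X ω * v (t + 1) ω ^ 2 ∂μ = s * ∫ ω, X ω ∂μ := by
  have hv : Integrable (fun ω => v (t + 1) ω ^ 2) μ :=
    integrable_sq_of_memLp_four (h.memLp_shock t)
  have h1 := condExp_mul_of_stronglyMeasurable_left (m := ℱ t) hX.stronglyMeasurable hi hv
  rw [← integral_condExp (ℱ.le t), ← integral_const_mul]
  refine integral_congr_ae ?_
  filter_upwards [h1, h.condExp_shock_sq t] with ω h2 h3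
  refine h2.trans ?_
  simp [h3, mul_comm]

theorem integral_shock_sq (h : IsIndividual μ ℱ δ₀ α v s C) (t : ℕ) :
    ∫ ω, v (t + 1) ω ^ 2 ∂μ = s := by
  have := h.integral_mul_shock_sq (t := t) (X := fun _ => 1) measurable_const
    (by simpa using integrable_sq_of_memLp_four (h.memLp_shock t))
  simpa using this

theorem variance_nonneg (h : IsIndividual μ ℱ δ₀ α v s C) : 0 ≤ s := by
  rw [← h.integral_shock_sq 0]
  exact integral_nonneg fun ω => sq_nonneg _

theorem integral_add_shock_sq (h : IsIndividual μ ℱ δ₀ α v s C) {t : ℕ} {X : Ω → ℝ}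
    (hX : Measurable[ℱ t] X) (hX4 : MemLp X 4 μ) :
    ∫ ω, (X ω + v (t + 1) ω) ^ 2 ∂μ = ∫ ω, X ω ^ 2 ∂μ + s := by
  have hXv := integrable_mul_of_memLp_four hX4 (h.memLp_shock t)
  have hX2 := integrable_sq_of_memLp_four hX4
  have hv2 := integrable_sq_of_memLp_four (h.memLp_shock t)
  calc ∫ ω, (X ω + v (t + 1) ω) ^ 2 ∂μ
      = ∫ ω, (X ω ^ 2 + 2 * (X ω * v (t + 1) ω) + v (t + 1) ω ^ 2) ∂μ := by
        congr 1; ext ω; ring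
    _ = _ := by
        rw [integral_add (hX2.fun_add (hXv.const_mul 2)) hv2, integral_add hX2 (hXv.const_mul 2),
          integral_const_mul, h.integral_mul_shock hX hXv, h.integral_shock_sq]
        ring

/-- One step of the recursion for fourth moments: the cubic term in the past vanishes by the
martingale difference property, and the cubic term in the shock is absorbed by its neighbours. -/
theorem integral_add_shock_pow_four_le (h : IsIndividual μ ℱ δ₀ α v s C) {t : ℕ} {X : Ω → ℝ}
    (hX : Measurable[ℱ t] X) (hX4 : MemLp X 4 μ) :
    ∫ ω, (X ω + v (t + 1) ω) ^ 4 ∂μ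
      ≤ ∫ ω, X ω ^ 4 ∂μ + 8 * s * ∫ ω, X ω ^ 2 ∂μ + 3 * C := by
  have hv := h.memLp_shock t
  have h3 : Integrable (fun ω => X ω ^ 3 * v (t + 1) ω) μ := by
    refine (integrable_mul_of_memLp_two (memLp_two_mul hX4 hX4) (memLp_two_mul hX4 hv)).congr
      (Eventually.of_forall fun ω => ?_)
    simp only
    ring
  have h2 : Integrable (fun ω => X ω ^ 2 * v (t + 1) ω ^ 2) μ := by
    refine (integrable_mul_sq hX4 hv).congr (Eventually.of_forall fun ω => ?_)
    simp only
    ring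
  have e3 := h.integral_mul_shock (hX.pow_const 3) h3
  have e2 := h.integral_mul_shock_sq (hX.pow_const 2) h2
  have i4 := integrable_pow_four hX4
  have iv := integrable_pow_four hv
  calc ∫ ω, (X ω + v (t + 1) ω) ^ 4 ∂μ
      ≤ ∫ ω, (X ω ^ 4 + 4 * (X ω ^ 3 * v (t + 1) ω) + 8 * (X ω ^ 2 * v (t + 1) ω ^ 2)
          + 3 * v (t + 1) ω ^ 4) ∂μ := by
        refine integral_mono (integrable_pow_four (hX4.add hv))
          (((i4.add (h3.const_mul 4)).add (h2.const_mul 8)).add (iv.const_mul 3)) fun ω => ?_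
        simp only
        nlinarith [sq_nonneg (v (t + 1) ω * (X ω - v (t + 1) ω))]
    _ = ∫ ω, X ω ^ 4 ∂μ + 8 * (s * ∫ ω, X ω ^ 2 ∂μ) + 3 * ∫ ω, v (t + 1) ω ^ 4 ∂μ := by
        rw [integral_add ((i4.fun_add (h3.const_mul 4)).fun_add (h2.const_mul 8)) (iv.const_mul 3),
          integral_add (i4.fun_add (h3.const_mul 4)) (h2.const_mul 8),
          integral_add i4 (h3.const_mul 4), integral_const_mul, integral_const_mul,
          integral_const_mul, e3, e2]
        ring
    _ ≤ _ := by linarith [h.fourth_moment_shock t]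

/-! ### Moments of the states -/

theorem integral_path_sq_succ (h : IsIndividual μ ℱ δ₀ α v s C) (t : ℕ) :
    ∫ ω, path ρ δ₀ v (t + 1) ω ^ 2 ∂μ = ρ ^ 2 * ∫ ω, path ρ δ₀ v t ω ^ 2 ∂μ + s := by
  have := h.integral_add_shock_sq ((h.measurable_path ρ t).const_mul ρ)
    ((h.memLp_path ρ t).const_mul ρ)
  simp only [mul_pow, integral_const_mul] at this
  exact this

theorem integral_path_sq_add (h : IsIndividual μ ℱ δ₀ α v s C) (t k : ℕ) :
    ∫ ω, path ρ δ₀ v (t + k) ω ^ 2 ∂μ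
      = ρ ^ (2 * k) * ∫ ω, path ρ δ₀ v t ω ^ 2 ∂μ + s * ∑ j ∈ Finset.range k, ρ ^ (2 * j) := by
  induction k with
  | zero => simp
  | succ k ih =>
    rw [← add_assoc, h.integral_path_sq_succ, ih, Finset.sum_range_succ']
    have : ∀ j, ρ ^ (2 * (j + 1)) = ρ ^ 2 * ρ ^ (2 * j) := fun j => by ring
    simp only [this, ← Finset.mul_sum]
    ring

theorem integral_mul_path (h : IsIndividual μ ℱ δ₀ α v s C) {t : ℕ} {X : Ω → ℝ}
    (hX : Measurable[ℱ t] X) (hX4 : MemLp X 4 μ) (k : ℕ) :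
    ∫ ω, X ω * path ρ δ₀ v (t + k) ω ∂μ = ρ ^ k * ∫ ω, X ω * path ρ δ₀ v t ω ∂μ := by
  induction k with
  | zero => simp
  | succ k ih =>
    have h1 := (integrable_mul_of_memLp_four hX4 (h.memLp_path ρ (t + k))).const_mul ρ
    have h2 := integrable_mul_of_memLp_four hX4 (h.memLp_shock (t + k))
    calc ∫ ω, X ω * path ρ δ₀ v (t + k + 1) ω ∂μ
        = ∫ ω, (ρ * (X ω * path ρ δ₀ v (t + k) ω) + X ω * v (t + k + 1) ω) ∂μ := by
          congr 1; ext ω; simp only [path, state]; ring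
      _ = _ := by
          rw [integral_add h1 h2, integral_const_mul, ih,
            h.integral_mul_shock (hX.mono (ℱ.mono (by omega)) le_rfl) h2]
          ring

theorem integral_path_mul_path (h : IsIndividual μ ℱ δ₀ α v s C) (t k : ℕ) :
    ∫ ω, path ρ δ₀ v t ω * path ρ δ₀ v (t + k) ω ∂μ
      = ρ ^ k * ∫ ω, path ρ δ₀ v t ω ^ 2 ∂μ := by
  rw [h.integral_mul_path (h.measurable_path ρ t) (h.memLp_path ρ t)]
  simp only [sq]

theorem integral_drift_mul_path (h : IsIndividual μ ℱ δ₀ α v s C) (t : ℕ) :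
    ∫ ω, α ω * path ρ δ₀ v t ω ∂μ = 0 := by
  have := h.integral_mul_path (ρ := ρ) h.measurable_drift h.memLp_drift t
  rw [zero_add] at this
  rw [this]
  simp only [path, state, h.uncorrelated, mul_zero]

theorem integral_path_mul_shock_of_le (h : IsIndividual μ ℱ δ₀ α v s C) {r t : ℕ} (hrt : r ≤ t) :
    ∫ ω, path ρ δ₀ v r ω * v (t + 1) ω ∂μ = 0 :=
  h.integral_mul_shock ((h.measurable_path ρ r).mono (ℱ.mono hrt) le_rfl)
    (integrable_mul_of_memLp_four (h.memLp_path ρ r) (h.memLp_shock t))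

theorem integral_path_mul_shock (h : IsIndividual μ ℱ δ₀ α v s C) (t k : ℕ) :
    ∫ ω, path ρ δ₀ v (t + 1 + k) ω * v (t + 1) ω ∂μ = ρ ^ k * s := by
  have h0 := h.integral_mul_path (ρ := ρ) (h.measurable_shock t) (h.memLp_shock t) k
  have h1 := (integrable_mul_of_memLp_four (h.memLp_path ρ t) (h.memLp_shock t)).const_mul ρ
  have h2 := integrable_sq_of_memLp_four (h.memLp_shock t)
  calc ∫ ω, path ρ δ₀ v (t + 1 + k) ω * v (t + 1) ω ∂μ
      = ∫ ω, v (t + 1) ω * path ρ δ₀ v (t + 1 + k) ω ∂μ := by simp only [mul_comm]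
    _ = ρ ^ k * ∫ ω, (ρ * (path ρ δ₀ v t ω * v (t + 1) ω) + v (t + 1) ω ^ 2) ∂μ := by
        rw [h0]; congr 2; ext ω; simp only [path, state]; ring
    _ = _ := by
        rw [integral_add h1 h2, integral_const_mul, h.integral_path_mul_shock_of_le le_rfl,
          h.integral_shock_sq]
        ring

/-- The increment over `k` periods has at least the variance of the shocks of these periods. -/
theorem le_integral_path_sub_sq (h : IsIndividual μ ℱ δ₀ α v s C) (t k : ℕ) :
    s * ∑ j ∈ Finset.range k, ρ ^ (2 * j)
      ≤ ∫ ω, (path ρ δ₀ v t ω - path ρ δ₀ v (t + k) ω) ^ 2 ∂μ := by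
  have i1 := integrable_sq_of_memLp_four (h.memLp_path ρ t)
  have i2 := integrable_sq_of_memLp_four (h.memLp_path ρ (t + k))
  have i3 := (integrable_mul_of_memLp_four (h.memLp_path ρ t) (h.memLp_path ρ (t + k))).const_mul 2
  have h0 : 0 ≤ ∫ ω, path ρ δ₀ v t ω ^ 2 ∂μ := integral_nonneg fun ω => sq_nonneg _
  calc s * ∑ j ∈ Finset.range k, ρ ^ (2 * j)
      ≤ (1 - ρ ^ k) ^ 2 * ∫ ω, path ρ δ₀ v t ω ^ 2 ∂μ
        + s * ∑ j ∈ Finset.range k, ρ ^ (2 * j) := by nlinarith [sq_nonneg (1 - ρ ^ k)]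
    _ = ∫ ω, (path ρ δ₀ v t ω ^ 2 - 2 * (path ρ δ₀ v t ω * path ρ δ₀ v (t + k) ω)
          + path ρ δ₀ v (t + k) ω ^ 2) ∂μ := by
        rw [integral_add (i1.sub' i3) i2, integral_sub i1 i3, integral_const_mul,
          h.integral_path_mul_path, h.integral_path_sq_add]
        ring
    _ = _ := by congr 1; ext ω; ring

/-- Second moments of the states, given bounds on the initial second moment, on the impulse
responses and on the sum of their squares. -/
theorem integral_path_sq_le (h : IsIndividual μ ℱ δ₀ α v s C) {T : ℕ} {K L B : ℝ}
    (h0 : ∫ ω, δ₀ ω ^ 2 ∂μ ≤ L * B) (hK : ∀ t ≤ T, ρ ^ (2 * t) ≤ K)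
    (hQ : ∑ j ∈ Finset.range T, ρ ^ (2 * j) ≤ K * B) {t : ℕ} (ht : t ≤ T) :
    ∫ ω, path ρ δ₀ v t ω ^ 2 ∂μ ≤ (L + s) * K * B := by
  have hs := h.variance_nonneg
  have h1 := h.integral_path_sq_add (ρ := ρ) 0 t
  rw [zero_add] at h1
  have hQt : ∑ j ∈ Finset.range t, ρ ^ (2 * j) ≤ K * B :=
    (Finset.sum_le_sum_of_subset_of_nonneg (Finset.range_mono ht)
      fun j _ _ => by rw [pow_mul]; positivity).trans hQ
  have hp : 0 ≤ ρ ^ (2 * t) := by rw [pow_mul]; positivity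
  rw [h1]
  calc ρ ^ (2 * t) * ∫ ω, path ρ δ₀ v 0 ω ^ 2 ∂μ + s * ∑ j ∈ Finset.range t, ρ ^ (2 * j)
      ≤ K * (L * B) + s * (K * B) := by
        gcongr
        · exact (hp.trans (hK t ht))
        · exact hK t ht
        · exact h0
    _ = _ := by ring

/-- The constant in the bound for the fourth moments of the states. -/
noncomputable def stateConst (s C K L : ℝ) : ℝ :=
  K ^ 2 * L + (8 * s * K * ((L + s) * K) + 3 * C) * K ^ 2

theorem integral_path_pow_four_le (h : IsIndividual μ ℱ δ₀ α v s C) {T : ℕ} {K L B : ℝ}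
    (hL : 0 ≤ L) (hB : 1 ≤ B) (hK1 : 1 ≤ K) (h0 : ∫ ω, δ₀ ω ^ 2 ∂μ ≤ L * B)
    (h04 : ∫ ω, δ₀ ω ^ 4 ∂μ ≤ L * B ^ 2) (hK : ∀ t ≤ T, ρ ^ (2 * t) ≤ K)
    (hQ : ∑ j ∈ Finset.range T, ρ ^ (2 * j) ≤ K * B) {t : ℕ} (ht : t ≤ T) :
    ∫ ω, path ρ δ₀ v t ω ^ 4 ∂μ ≤ stateConst s C K L * B ^ 2 := by
  have hs := h.variance_nonneg
  have hC := h.fourth_moment_nonneg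
  set R := 8 * s * K * ((L + s) * K) + 3 * C
  have hR : 0 ≤ R := by positivity
  have hrec : ∀ t ≤ T, ∫ ω, path ρ δ₀ v t ω ^ 4 ∂μ
      ≤ ρ ^ (4 * t) * ∫ ω, δ₀ ω ^ 4 ∂μ + R * B * ∑ j ∈ Finset.range t, ρ ^ (4 * j) := by
    intro t
    induction t with
    | zero => intro _; simp [path, state]
    | succ t ih =>
      intro ht'
      have ih' := ih (by omega)
      have h1 := h.integral_add_shock_pow_four_le ((h.measurable_path ρ t).const_mul ρ)
        ((h.memLp_path ρ t).const_mul ρ)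
      simp only [mul_pow, integral_const_mul] at h1
      have h2 := h.integral_path_sq_le h0 hK hQ (t := t) (by omega)
      have hρ : ρ ^ 2 ≤ K := by simpa using hK 1 (by omega)
      have hCB : 3 * C ≤ 3 * C * B := le_mul_of_one_le_right (by positivity) hB
      have h3 : 8 * s * (ρ ^ 2 * ∫ ω, path ρ δ₀ v t ω ^ 2 ∂μ) + 3 * C ≤ R * B := by
        calc 8 * s * (ρ ^ 2 * ∫ ω, path ρ δ₀ v t ω ^ 2 ∂μ) + 3 * C
            ≤ 8 * s * (K * ((L + s) * K * B)) + 3 * C * B := by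
              refine add_le_add ?_ hCB
              gcongr
          _ = R * B := by simp only [R]; ring
      calc ∫ ω, path ρ δ₀ v (t + 1) ω ^ 4 ∂μ
          ≤ ρ ^ 4 * ∫ ω, path ρ δ₀ v t ω ^ 4 ∂μ
            + 8 * s * (ρ ^ 2 * ∫ ω, path ρ δ₀ v t ω ^ 2 ∂μ) + 3 * C := h1
        _ ≤ ρ ^ 4 * (ρ ^ (4 * t) * ∫ ω, δ₀ ω ^ 4 ∂μ
              + R * B * ∑ j ∈ Finset.range t, ρ ^ (4 * j)) + R * B := by
            have : 0 ≤ ρ ^ 4 := by positivity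
            nlinarith [mul_le_mul_of_nonneg_left ih' this]
        _ = _ := by
            rw [Finset.sum_range_succ']
            have : ∀ j, ρ ^ (4 * (j + 1)) = ρ ^ 4 * ρ ^ (4 * j) := fun j => by ring
            simp only [this, ← Finset.mul_sum]
            ring
  have hp4 : ∀ j ≤ T, ρ ^ (4 * j) ≤ K * ρ ^ (2 * j) := by
    intro j hj
    have h1 : ρ ^ (4 * j) = ρ ^ (2 * j) * ρ ^ (2 * j) := by ring
    have h2 : 0 ≤ ρ ^ (2 * j) := by rw [pow_mul]; positivity
    rw [h1]
    exact mul_le_mul_of_nonneg_right (hK j hj) h2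
  have hQ4 : ∑ j ∈ Finset.range t, ρ ^ (4 * j) ≤ K * (K * B) := by
    calc ∑ j ∈ Finset.range t, ρ ^ (4 * j)
        ≤ ∑ j ∈ Finset.range t, K * ρ ^ (2 * j) :=
          Finset.sum_le_sum fun j hj => hp4 j (by have := Finset.mem_range.1 hj; omega)
      _ ≤ ∑ j ∈ Finset.range T, K * ρ ^ (2 * j) :=
          Finset.sum_le_sum_of_subset_of_nonneg (Finset.range_mono ht)
            fun j _ _ => by rw [pow_mul]; positivity
      _ ≤ _ := by rw [← Finset.mul_sum]; gcongr
  have hpt : ρ ^ (4 * t) ≤ K * K :=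
    (hp4 t ht).trans (by gcongr; exact hK t ht)
  calc ∫ ω, path ρ δ₀ v t ω ^ 4 ∂μ
      ≤ ρ ^ (4 * t) * ∫ ω, δ₀ ω ^ 4 ∂μ + R * B * ∑ j ∈ Finset.range t, ρ ^ (4 * j) := hrec t ht
    _ ≤ K * K * (L * B ^ 2) + R * B * (K * (K * B)) := by gcongr
    _ = _ := by simp only [stateConst, R]; ring

/-- Fourth moments of partial sums of every second shock grow at most quadratically. -/
theorem integral_sum_shock_pow_four_le (h : IsIndividual μ ℱ δ₀ α v s C) (o m : ℕ) :
    ∫ ω, (∑ a ∈ Finset.range m, v (2 * a + o + 1) ω) ^ 4 ∂μ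
      ≤ (8 * s ^ 2 + 3 * C) * (m : ℝ) ^ 2 := by
  have hs := h.variance_nonneg
  have hC := h.fourth_moment_nonneg
  have hmeas : ∀ k, Measurable[ℱ (2 * k + o)]
      (fun ω => ∑ a ∈ Finset.range k, v (2 * a + o + 1) ω) := by
    intro k
    refine Finset.measurable_sum _ fun a ha => ?_
    have := Finset.mem_range.1 ha
    exact (h.measurable_shock (2 * a + o)).mono (ℱ.mono (by omega)) le_rfl
  have hmem : ∀ k, MemLp (fun ω => ∑ a ∈ Finset.range k, v (2 * a + o + 1) ω) 4 μ :=
    fun k => memLp_finsetSum _ fun a _ => h.memLp_shock _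
  have h2 : ∀ k : ℕ, ∫ ω, (∑ a ∈ Finset.range k, v (2 * a + o + 1) ω) ^ 2 ∂μ = k * s := by
    intro k
    induction k with
    | zero => simp
    | succ k ih =>
      simp only [Finset.sum_range_succ]
      rw [h.integral_add_shock_sq (hmeas k) (hmem k), ih]
      push_cast
      ring
  induction m with
  | zero => simp
  | succ k ih =>
    simp only [Finset.sum_range_succ]
    refine (h.integral_add_shock_pow_four_le (hmeas k) (hmem k)).trans ?_
    rw [h2]
    push_cast
    nlinarith [mul_nonneg hC (Nat.cast_nonneg k : (0 : ℝ) ≤ k), sq_nonneg s]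

/-! ### Decomposition of the estimation error -/

section Parts

variable {Ω : Type*}

/-- The observable of the individual at time `t`, as a random variable. -/
abbrev obs (ρ : ℝ) (δ₀ α : Ω → ℝ) (v : ℕ → Ω → ℝ) (t : ℕ) (ω : Ω) : ℝ :=
  observable ρ (α ω) (δ₀ ω) (fun t => v t ω) t

/-- The estimation error `numer - ρ * denom` of one individual, as a random variable. -/
noncomputable def score (T : ℕ) (ρ : ℝ) (δ₀ α : Ω → ℝ) (v : ℕ → Ω → ℝ) (ω : Ω) : ℝ :=
  numer T (fun t => obs ρ δ₀ α v t ω) - ρ * denom T (fun t => obs ρ δ₀ α v t ω)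

/-- The martingale part of the estimation error: `o = 0` for even, `o = 1` for odd times. -/
noncomputable def martPart (m o : ℕ) (ρ : ℝ) (δ₀ : Ω → ℝ) (v : ℕ → Ω → ℝ) (ω : Ω) : ℝ :=
  ∑ a ∈ Finset.range m, path ρ δ₀ v (2 * a + (2 + o)) ω * v (2 * a + (2 + o) + 1) ω

/-- The part of the estimation error that is due to demeaning. -/
noncomputable def demeanPart (m o : ℕ) (ρ : ℝ) (δ₀ : Ω → ℝ) (v : ℕ → Ω → ℝ) (ω : Ω) : ℝ :=
  1 / (m : ℝ) * ∑ a ∈ Finset.range m, path ρ δ₀ v (2 * a + (2 + o)) ω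
    * ∑ b ∈ Finset.range m, v (2 * b + (2 + o) + 1) ω

/-- One summand of the bias correction. -/
noncomputable def corrTerm (a : ℕ) (ρ : ℝ) (δ₀ α : Ω → ℝ) (v : ℕ → Ω → ℝ) (ω : Ω) : ℝ :=
  2 * (obs ρ δ₀ α v (a + 1) ω * obs ρ δ₀ α v (a + 2) ω)
    - obs ρ δ₀ α v 1 ω * obs ρ δ₀ α v (2 * a + 2) ω
    - obs ρ δ₀ α v 2 ω * obs ρ δ₀ α v (2 * a + 1) ω

/-- The denominator contribution of one individual, as a random variable. -/
noncomputable def info (T : ℕ) (ρ : ℝ) (δ₀ α : Ω → ℝ) (v : ℕ → Ω → ℝ) (ω : Ω) : ℝ :=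
  denom T (fun t => obs ρ δ₀ α v t ω)

theorem score_eq {m : ℕ} (hm : 0 < m) (ρ : ℝ) (δ₀ α : Ω → ℝ) (v : ℕ → Ω → ℝ) (ω : Ω) :
    score (2 * m + 2) ρ δ₀ α v ω
      = martPart m 1 ρ δ₀ v ω + martPart m 0 ρ δ₀ v ω
        - demeanPart m 1 ρ δ₀ v ω - demeanPart m 0 ρ δ₀ v ω
        + 1 / (m : ℝ) * ∑ a ∈ Finset.range m, corrTerm a ρ δ₀ α v ω := by
  have := numer_sub_denom m hm ρ (α ω) (δ₀ ω) (fun t => v t ω)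
  simp only [score, martPart, demeanPart, corrTerm, obs, path, ← Finset.sum_mul]
  exact this

theorem info_eq {m : ℕ} (hm : 0 < m) (ρ : ℝ) (δ₀ α : Ω → ℝ) (v : ℕ → Ω → ℝ) (ω : Ω) :
    info (2 * m + 2) ρ δ₀ α v ω
      = sumSq m (fun a => path ρ δ₀ v (2 * a + 3) ω)
        + sumSq m (fun a => path ρ δ₀ v (2 * a + 2) ω) :=
  denom_observable m hm ρ (α ω) (δ₀ ω) (fun t => v t ω)

end Parts

variable {Ω : Type*} [m0 : MeasurableSpace Ω] {μ : Measure Ω}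
  {ℱ : Filtration ℕ m0} {δ₀ α : Ω → ℝ} {v : ℕ → Ω → ℝ} {s C ρ : ℝ}

theorem memLp_obs (h : IsIndividual μ ℱ δ₀ α v s C) (ρ : ℝ) (t : ℕ) :
    MemLp (obs ρ δ₀ α v t) 4 μ :=
  h.memLp_drift.add (h.memLp_path ρ t)

theorem memLp_martPart (h : IsIndividual μ ℱ δ₀ α v s C) (m o : ℕ) (ρ : ℝ) :
    MemLp (martPart m o ρ δ₀ v) 2 μ :=
  memLp_finsetSum _ fun _ _ => memLp_two_mul (h.memLp_path ρ _) (h.memLp_shock _)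

theorem memLp_demeanTerm (h : IsIndividual μ ℱ δ₀ α v s C) (m o a : ℕ) (ρ : ℝ) :
    MemLp (fun ω => path ρ δ₀ v (2 * a + (2 + o)) ω
      * ∑ b ∈ Finset.range m, v (2 * b + (2 + o) + 1) ω) 2 μ :=
  memLp_two_mul (h.memLp_path ρ _) (memLp_finsetSum _ fun _ _ => h.memLp_shock _)

theorem memLp_sumSq (h : IsIndividual μ ℱ δ₀ α v s C) {m : ℕ} (o : ℕ) (ρ : ℝ) :
    MemLp (fun ω => sumSq m (fun a => path ρ δ₀ v (2 * a + o) ω)) 2 μ := by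
  simp only [sumSq, sq]
  refine memLp_finsetSum _ fun a _ => ?_
  have : MemLp (fun ω => path ρ δ₀ v (2 * a + o) ω
      - 1 / (m : ℝ) * ∑ b ∈ Finset.range m, path ρ δ₀ v (2 * b + o) ω) 4 μ :=
    (h.memLp_path ρ _).sub ((memLp_finsetSum _ fun b _ => h.memLp_path ρ _).const_mul _)
  exact memLp_two_mul this this

theorem memLp_demeanPart (h : IsIndividual μ ℱ δ₀ α v s C) (m o : ℕ) (ρ : ℝ) :
    MemLp (demeanPart m o ρ δ₀ v) 2 μ :=
  (memLp_finsetSum _ fun a _ => h.memLp_demeanTerm m o a ρ).const_mul _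

theorem memLp_corrTerm (h : IsIndividual μ ℱ δ₀ α v s C) (a : ℕ) (ρ : ℝ) :
    MemLp (corrTerm a ρ δ₀ α v) 2 μ :=
  (((memLp_two_mul (h.memLp_obs ρ _) (h.memLp_obs ρ _)).const_mul 2).sub
    (memLp_two_mul (h.memLp_obs ρ _) (h.memLp_obs ρ _))).sub
    (memLp_two_mul (h.memLp_obs ρ _) (h.memLp_obs ρ _))

theorem memLp_corr (h : IsIndividual μ ℱ δ₀ α v s C) (m : ℕ) (ρ : ℝ) :
    MemLp (fun ω => 1 / (m : ℝ) * ∑ a ∈ Finset.range m, corrTerm a ρ δ₀ α v ω) 2 μ :=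
  (memLp_finsetSum _ fun a _ => h.memLp_corrTerm a ρ).const_mul _

theorem memLp_score (h : IsIndividual μ ℱ δ₀ α v s C) {m : ℕ} (hm : 0 < m) (ρ : ℝ) :
    MemLp (score (2 * m + 2) ρ δ₀ α v) 2 μ := by
  have := ((((h.memLp_martPart m 1 ρ).add (h.memLp_martPart m 0 ρ)).sub
    (h.memLp_demeanPart m 1 ρ)).sub (h.memLp_demeanPart m 0 ρ)).add (h.memLp_corr m ρ)
  exact this.ae_eq (Eventually.of_forall fun ω => (score_eq hm ρ δ₀ α v ω).symm)

theorem memLp_info (h : IsIndividual μ ℱ δ₀ α v s C) {m : ℕ} (hm : 0 < m) (ρ : ℝ) :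
    MemLp (info (2 * m + 2) ρ δ₀ α v) 2 μ :=
  ((h.memLp_sumSq 3 ρ).add (h.memLp_sumSq 2 ρ)).ae_eq
    (Eventually.of_forall fun ω => (info_eq hm ρ δ₀ α v ω).symm)

/-! ### Bounds through fourth moments -/

theorem integral_obs_pow_four_le (h : IsIndividual μ ℱ δ₀ α v s C) {t : ℕ} {b : ℝ}
    (hα : ∫ ω, α ω ^ 4 ∂μ ≤ b) (hy : ∫ ω, path ρ δ₀ v t ω ^ 4 ∂μ ≤ b) :
    ∫ ω, obs ρ δ₀ α v t ω ^ 4 ∂μ ≤ 16 * b := by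
  have := integral_add_pow_four_le h.memLp_drift (h.memLp_path ρ t)
  calc ∫ ω, obs ρ δ₀ α v t ω ^ 4 ∂μ
      ≤ 8 * (∫ ω, α ω ^ 4 ∂μ + ∫ ω, path ρ δ₀ v t ω ^ 4 ∂μ) := this
    _ ≤ _ := by linarith

theorem integral_corr_sq_le (h : IsIndividual μ ℱ δ₀ α v s C) {m : ℕ} (hm : 0 < m) {b : ℝ}
    (hα : ∫ ω, α ω ^ 4 ∂μ ≤ b) (hy : ∀ t ≤ 2 * m + 2, ∫ ω, path ρ δ₀ v t ω ^ 4 ∂μ ≤ b) :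
    ∫ ω, (1 / (m : ℝ) * ∑ a ∈ Finset.range m, corrTerm a ρ δ₀ α v ω) ^ 2 ∂μ ≤ 288 * b := by
  refine integral_average_sq_le hm (fun a _ => h.memLp_corrTerm a ρ) fun a ha => ?_
  have hprod : ∀ t ≤ 2 * m + 2, ∀ r ≤ 2 * m + 2,
      ∫ ω, (obs ρ δ₀ α v t ω * obs ρ δ₀ α v r ω) ^ 2 ∂μ ≤ 16 * b := by
    intro t ht r hr
    have h1 := integral_mul_sq_le (h.memLp_obs ρ t) (h.memLp_obs ρ r) one_pos
    have h2 := h.integral_obs_pow_four_le hα (hy t ht)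
    have h3 := h.integral_obs_pow_four_le hα (hy r hr)
    linarith
  have hi := fun t r => integrable_mul_sq (h.memLp_obs ρ t) (h.memLp_obs ρ r)
  calc ∫ ω, corrTerm a ρ δ₀ α v ω ^ 2 ∂μ
      ≤ ∫ ω, (12 * (obs ρ δ₀ α v (a + 1) ω * obs ρ δ₀ α v (a + 2) ω) ^ 2
          + 3 * (obs ρ δ₀ α v 1 ω * obs ρ δ₀ α v (2 * a + 2) ω) ^ 2
          + 3 * (obs ρ δ₀ α v 2 ω * obs ρ δ₀ α v (2 * a + 1) ω) ^ 2) ∂μ := by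
        refine integral_mono (h.memLp_corrTerm a ρ).integrable_sq
          ((((hi _ _).const_mul 12).add ((hi _ _).const_mul 3)).add ((hi _ _).const_mul 3))
          fun ω => ?_
        simp only [corrTerm]
        set p := obs ρ δ₀ α v (a + 1) ω * obs ρ δ₀ α v (a + 2) ω
        set q := obs ρ δ₀ α v 1 ω * obs ρ δ₀ α v (2 * a + 2) ω
        set r := obs ρ δ₀ α v 2 ω * obs ρ δ₀ α v (2 * a + 1) ω
        nlinarith [sq_nonneg (2 * p + q), sq_nonneg (2 * p + r), sq_nonneg (q - r)]
    _ ≤ _ := by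
        rw [integral_add (((hi _ _).const_mul 12).fun_add ((hi _ _).const_mul 3))
          ((hi _ _).const_mul 3), integral_add ((hi _ _).const_mul 12) ((hi _ _).const_mul 3),
          integral_const_mul, integral_const_mul, integral_const_mul]
        have h1 := hprod (a + 1) (by omega) (a + 2) (by omega)
        have h2 := hprod 1 (by omega) (2 * a + 2) (by omega)
        have h3 := hprod 2 (by omega) (2 * a + 1) (by omega)
        linarith

theorem integral_info_sq_le (h : IsIndividual μ ℱ δ₀ α v s C) {m : ℕ} (hm : 0 < m) {b : ℝ}
    (hy : ∀ t ≤ 2 * m + 2, ∫ ω, path ρ δ₀ v t ω ^ 4 ∂μ ≤ b) :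
    ∫ ω, info (2 * m + 2) ρ δ₀ α v ω ^ 2 ∂μ ≤ b * (2 * m + 2) ^ 2 := by
  have hi := fun t => integrable_pow_four (h.memLp_path ρ t)
  have hsum : ∀ o, Integrable (fun ω => ∑ a ∈ Finset.range m, path ρ δ₀ v (2 * a + o) ω ^ 4) μ :=
    fun o => integrable_finsetSum _ fun a _ => hi _
  have hb : 0 ≤ b := (integral_nonneg fun ω => by positivity).trans (hy 0 (by omega))
  have hbound : ∀ o ≤ 3, ∫ ω, ∑ a ∈ Finset.range m, path ρ δ₀ v (2 * a + o) ω ^ 4 ∂μ ≤ m * b := by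
    intro o ho
    rw [integral_finsetSum _ fun a _ => hi _]
    calc _ ≤ ∑ a ∈ Finset.range m, b := by
          gcongr with a ha
          have := Finset.mem_range.1 ha
          exact hy _ (by omega)
      _ = _ := by simp
  calc ∫ ω, info (2 * m + 2) ρ δ₀ α v ω ^ 2 ∂μ
      ≤ ∫ ω, 2 * (m : ℝ) * (∑ a ∈ Finset.range m, path ρ δ₀ v (2 * a + 3) ω ^ 4
          + ∑ a ∈ Finset.range m, path ρ δ₀ v (2 * a + 2) ω ^ 4) ∂μ := by
        refine integral_mono (h.memLp_info hm ρ).integrable_sq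
          (((hsum 3).add (hsum 2)).const_mul _) fun ω => ?_
        simp only [info_eq hm]
        have hle : ∀ o, sumSq m (fun a => path ρ δ₀ v (2 * a + o) ω) ^ 2
            ≤ m * ∑ a ∈ Finset.range m, path ρ δ₀ v (2 * a + o) ω ^ 4 := by
          intro o
          have h1 := sumSq_le m hm (fun a => path ρ δ₀ v (2 * a + o) ω)
          have h2 := sumSq_nonneg m (fun a => path ρ δ₀ v (2 * a + o) ω)
          have h3 := sq_sum_le_card_mul_sum_sq (s := Finset.range m)
            (f := fun a => path ρ δ₀ v (2 * a + o) ω ^ 2)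
          simp only [Finset.card_range, ← pow_mul] at h3
          exact (pow_le_pow_left₀ h2 h1 2).trans h3
        have h3 := hle 3
        have h2 := hle 2
        nlinarith [sq_nonneg (sumSq m (fun a => path ρ δ₀ v (2 * a + 3) ω)
          - sumSq m (fun a => path ρ δ₀ v (2 * a + 2) ω))]
    _ = 2 * (m : ℝ) * (∫ ω, ∑ a ∈ Finset.range m, path ρ δ₀ v (2 * a + 3) ω ^ 4 ∂μ
          + ∫ ω, ∑ a ∈ Finset.range m, path ρ δ₀ v (2 * a + 2) ω ^ 4 ∂μ) := by
        rw [integral_const_mul, integral_add (hsum 3) (hsum 2)]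
    _ ≤ 2 * (m : ℝ) * (m * b + m * b) := by
        gcongr
        · exact hbound 3 le_rfl
        · exact hbound 2 (by omega)
    _ ≤ _ := by nlinarith [mul_nonneg hb (Nat.cast_nonneg m : (0 : ℝ) ≤ m)]

variable [IsProbabilityMeasure μ]

/-! ### The mean of the estimation error -/

theorem integral_martPart (h : IsIndividual μ ℱ δ₀ α v s C) (m o : ℕ) :
    ∫ ω, martPart m o ρ δ₀ v ω ∂μ = 0 := by
  simp only [martPart]
  rw [integral_finsetSum _ fun a _ =>
    integrable_mul_of_memLp_four (h.memLp_path ρ _) (h.memLp_shock _)]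
  exact Finset.sum_eq_zero fun a _ => h.integral_path_mul_shock_of_le le_rfl

theorem integral_demeanPart (h : IsIndividual μ ℱ δ₀ α v s C) (m o : ℕ) :
    ∫ ω, demeanPart m o ρ δ₀ v ω ∂μ
      = s / m * ∑ a ∈ Finset.range m, ∑ j ∈ Finset.range a, ρ ^ (2 * j + 1) := by
  have hone : ∀ a ∈ Finset.range m, ∫ ω, path ρ δ₀ v (2 * a + (2 + o)) ω
      * ∑ b ∈ Finset.range m, v (2 * b + (2 + o) + 1) ω ∂μ
      = s * ∑ j ∈ Finset.range a, ρ ^ (2 * j + 1) := by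
    intro a ha
    have ha' := Finset.mem_range.1 ha
    simp only [Finset.mul_sum]
    rw [integral_finsetSum _ fun b _ =>
      integrable_mul_of_memLp_four (h.memLp_path ρ _) (h.memLp_shock _)]
    -- Only the shocks that precede the state contribute.
    have hzero : ∀ b ∈ Finset.range m, b ∉ Finset.range a →
        ∫ ω, path ρ δ₀ v (2 * a + (2 + o)) ω * v (2 * b + (2 + o) + 1) ω ∂μ = 0 := by
      intro b _ hb
      rw [Finset.mem_range, not_lt] at hb
      exact h.integral_path_mul_shock_of_le (by omega)
    rw [← Finset.sum_subset (Finset.range_mono ha'.le) hzero,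
      ← Finset.sum_range_reflect]
    refine Finset.sum_congr rfl fun j hj => ?_
    have hj' := Finset.mem_range.1 hj
    have := h.integral_path_mul_shock (ρ := ρ) (2 * (a - 1 - j) + (2 + o)) (2 * j + 1)
    rw [show 2 * (a - 1 - j) + (2 + o) + 1 + (2 * j + 1) = 2 * a + (2 + o) by omega] at this
    rw [this, mul_comm]
  simp only [demeanPart]
  rw [integral_const_mul, integral_finsetSum _ fun a _ =>
    (h.memLp_demeanTerm m o a ρ).integrable (by norm_num), Finset.sum_congr rfl hone,
    ← Finset.mul_sum]
  ring

theorem integral_obs_mul_obs (h : IsIndividual μ ℱ δ₀ α v s C) (t k : ℕ) :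
    ∫ ω, obs ρ δ₀ α v t ω * obs ρ δ₀ α v (t + k) ω ∂μ
      = ∫ ω, α ω ^ 2 ∂μ + ρ ^ k * ∫ ω, path ρ δ₀ v t ω ^ 2 ∂μ := by
  have i1 := integrable_sq_of_memLp_four h.memLp_drift
  have i2 := integrable_mul_of_memLp_four h.memLp_drift (h.memLp_path ρ t)
  have i3 := integrable_mul_of_memLp_four h.memLp_drift (h.memLp_path ρ (t + k))
  have i4 := integrable_mul_of_memLp_four (h.memLp_path ρ t) (h.memLp_path ρ (t + k))
  calc ∫ ω, obs ρ δ₀ α v t ω * obs ρ δ₀ α v (t + k) ω ∂μ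
      = ∫ ω, (α ω ^ 2 + α ω * path ρ δ₀ v t ω + α ω * path ρ δ₀ v (t + k) ω
          + path ρ δ₀ v t ω * path ρ δ₀ v (t + k) ω) ∂μ := by
        congr 1; ext ω; simp only [obs, observable, path]; ring
    _ = _ := by
        rw [integral_add ((i1.fun_add i2).fun_add i3) i4, integral_add (i1.fun_add i2) i3,
          integral_add i1 i2, h.integral_drift_mul_path, h.integral_drift_mul_path,
          h.integral_path_mul_path]
        ring

/-- The mean of one summand of the bias correction. The contributions of the drift and of the
initial value cancel. -/
theorem integral_corrTerm (h : IsIndividual μ ℱ δ₀ α v s C) (a : ℕ) :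
    ∫ ω, corrTerm a ρ δ₀ α v ω ∂μ
      = 2 * s * ∑ j ∈ Finset.range a, ρ ^ (2 * j + 1)
        - s * if a = 0 then 0 else ρ ^ (2 * a - 1) := by
  have hi := fun t r => integrable_mul_of_memLp_four (h.memLp_obs ρ t) (h.memLp_obs ρ r)
  have hsplit : ∫ ω, corrTerm a ρ δ₀ α v ω ∂μ
      = 2 * ∫ ω, obs ρ δ₀ α v (a + 1) ω * obs ρ δ₀ α v (a + 2) ω ∂μ
        - ∫ ω, obs ρ δ₀ α v 1 ω * obs ρ δ₀ α v (2 * a + 2) ω ∂μ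
        - ∫ ω, obs ρ δ₀ α v 2 ω * obs ρ δ₀ α v (2 * a + 1) ω ∂μ := by
    simp only [corrTerm]
    rw [integral_sub (((hi _ _).const_mul 2).sub' (hi _ _)) (hi _ _),
      integral_sub ((hi _ _).const_mul 2) (hi _ _), integral_const_mul]
  have e1 := h.integral_obs_mul_obs (ρ := ρ) (a + 1) 1
  have e2 := h.integral_obs_mul_obs (ρ := ρ) 1 (2 * a + 1)
  have c1 := h.integral_path_sq_add (ρ := ρ) 1 a
  rw [add_comm 1 a] at c1
  rw [show 1 + (2 * a + 1) = 2 * a + 2 by ring] at e2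
  have hQ : ∑ j ∈ Finset.range a, ρ ^ (2 * j + 1) = ρ * ∑ j ∈ Finset.range a, ρ ^ (2 * j) := by
    rw [Finset.mul_sum]
    exact Finset.sum_congr rfl fun j _ => by ring
  rw [hsplit, e1, e2, c1, hQ]
  rcases Nat.eq_zero_or_pos a with rfl | ha
  · have e3 := h.integral_obs_mul_obs (ρ := ρ) 1 1
    simp only [mul_comm (obs ρ δ₀ α v 2 _)]
    simp only [Nat.reduceAdd, mul_zero, zero_add] at e3 ⊢
    rw [e3]
    simp
    ring
  · obtain ⟨b, rfl⟩ : ∃ b, a = b + 1 := ⟨a - 1, by omega⟩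
    have e3 := h.integral_obs_mul_obs (ρ := ρ) 2 (2 * b + 1)
    have c2 := h.integral_path_sq_succ (ρ := ρ) 1
    rw [show 2 + (2 * b + 1) = 2 * (b + 1) + 1 by ring] at e3
    simp only [Nat.reduceAdd] at c2
    rw [e3, c2, if_neg (Nat.succ_ne_zero b), show 2 * (b + 1) - 1 = 2 * b + 1 by omega]
    ring

/-- The bias that survives the correction. -/
theorem integral_score (h : IsIndividual μ ℱ δ₀ α v s C) (k : ℕ) :
    ∫ ω, score (2 * (k + 1) + 2) ρ δ₀ α v ω ∂μ
      = -(s / (k + 1 : ℕ) * ∑ j ∈ Finset.range k, ρ ^ (2 * j + 1)) := by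
  have hint : ∀ {f : Ω → ℝ}, MemLp f 2 μ → Integrable f μ := fun hf => hf.integrable (by norm_num)
  have i1 := hint (h.memLp_martPart (k + 1) 1 ρ)
  have i2 := hint (h.memLp_martPart (k + 1) 0 ρ)
  have i3 := hint (h.memLp_demeanPart (k + 1) 1 ρ)
  have i4 := hint (h.memLp_demeanPart (k + 1) 0 ρ)
  have i5 := hint (h.memLp_corr (k + 1) ρ)
  simp only [score_eq k.succ_pos]
  rw [integral_add (((i1.fun_add i2).sub' i3).sub' i4) i5, integral_sub ((i1.fun_add i2).sub' i3) i4,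
    integral_sub (i1.fun_add i2) i3, integral_add i1 i2, h.integral_martPart, h.integral_martPart,
    h.integral_demeanPart, h.integral_demeanPart, integral_const_mul,
    integral_finsetSum _ fun a _ => hint (h.memLp_corrTerm a ρ)]
  simp only [h.integral_corrTerm, Finset.sum_sub_distrib, ← Finset.mul_sum]
  have hg : ∑ a ∈ Finset.range (k + 1), (if a = 0 then 0 else ρ ^ (2 * a - 1))
      = ∑ j ∈ Finset.range k, ρ ^ (2 * j + 1) := by
    rw [Finset.sum_range_succ']
    simp [show ∀ j, 2 * (j + 1) - 1 = 2 * j + 1 by omega]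
  rw [hg]
  ring

theorem abs_integral_score_le (h : IsIndividual μ ℱ δ₀ α v s C) {m : ℕ} (hm : 0 < m) :
    |∫ ω, score (2 * m + 2) ρ δ₀ α v ω ∂μ|
      ≤ s / m * ∑ j ∈ Finset.range m, ρ ^ (2 * j) := by
  obtain ⟨k, rfl⟩ : ∃ k, m = k + 1 := ⟨m - 1, by omega⟩
  have hs := h.variance_nonneg
  rw [h.integral_score, abs_neg, abs_mul, abs_of_nonneg (by positivity)]
  gcongr
  have hp : ∀ j, 0 ≤ ρ ^ (2 * j) := fun j => by rw [pow_mul]; positivity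
  have hterm : ∀ j, |ρ ^ (2 * j + 1)| ≤ (ρ ^ (2 * j) + ρ ^ (2 * (j + 1))) / 2 := by
    intro j
    have h1 : ρ ^ (2 * j + 1) = ρ ^ (2 * j) * ρ := by ring
    have h2 : ρ ^ (2 * (j + 1)) = ρ ^ (2 * j) * ρ ^ 2 := by ring
    have h3 := mul_nonneg (hp j) (sq_nonneg (1 - |ρ|))
    rw [sub_sq, sq_abs] at h3
    rw [h1, h2, abs_mul, abs_of_nonneg (hp j)]
    linarith
  have hlast := Finset.sum_range_succ (fun j => ρ ^ (2 * j)) k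
  have hfirst := Finset.sum_range_succ' (fun j => ρ ^ (2 * j)) k
  calc |∑ j ∈ Finset.range k, ρ ^ (2 * j + 1)|
      ≤ ∑ j ∈ Finset.range k, |ρ ^ (2 * j + 1)| := Finset.abs_sum_le_sum_abs _ _
    _ ≤ ∑ j ∈ Finset.range k, (ρ ^ (2 * j) + ρ ^ (2 * (j + 1))) / 2 :=
        Finset.sum_le_sum fun j _ => hterm j
    _ = (∑ j ∈ Finset.range k, ρ ^ (2 * j) + ∑ j ∈ Finset.range k, ρ ^ (2 * (j + 1))) / 2 := by
        rw [← Finset.sum_add_distrib, Finset.sum_div]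
    _ ≤ _ := by
        have := hp k
        simp only [mul_zero, pow_zero] at hfirst
        linarith

/-! ### The second moment of the estimation error -/

theorem integral_martPart_sq (h : IsIndividual μ ℱ δ₀ α v s C) (m o : ℕ) :
    ∫ ω, martPart m o ρ δ₀ v ω ^ 2 ∂μ
      = s * ∑ a ∈ Finset.range m, ∫ ω, path ρ δ₀ v (2 * a + (2 + o)) ω ^ 2 ∂μ := by
  induction m with
  | zero => simp [martPart]
  | succ k ih =>
    set t := 2 * k + (2 + o)
    have hM := h.memLp_martPart k o ρ
    have hy := h.memLp_path ρ t
    have hv := h.memLp_shock t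
    have hyv := memLp_two_mul hy hv
    have hmeas : Measurable[ℱ t] (martPart k o ρ δ₀ v) := by
      refine Finset.measurable_sum _ fun a ha => ?_
      have := Finset.mem_range.1 ha
      exact ((h.measurable_path ρ _).mono (ℱ.mono (by omega)) le_rfl).mul
        ((h.measurable_shock _).mono (ℱ.mono (by omega)) le_rfl)
    have i1 := hM.integrable_sq
    have i2 : Integrable (fun ω => martPart k o ρ δ₀ v ω * path ρ δ₀ v t ω * v (t + 1) ω) μ := by
      refine (integrable_mul_of_memLp_two hM hyv).congr (Eventually.of_forall fun ω => ?_)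
      simp only
      ring
    have i3 : Integrable (fun ω => path ρ δ₀ v t ω ^ 2 * v (t + 1) ω ^ 2) μ := by
      refine (integrable_mul_sq hy hv).congr (Eventually.of_forall fun ω => ?_)
      simp only
      ring
    calc ∫ ω, martPart (k + 1) o ρ δ₀ v ω ^ 2 ∂μ
        = ∫ ω, (martPart k o ρ δ₀ v ω ^ 2
            + 2 * (martPart k o ρ δ₀ v ω * path ρ δ₀ v t ω * v (t + 1) ω)
            + path ρ δ₀ v t ω ^ 2 * v (t + 1) ω ^ 2) ∂μ := by
          congr 1; ext ω
          simp only [martPart, Finset.sum_range_succ, t]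
          ring
      _ = _ := by
          rw [integral_add (i1.fun_add (i2.const_mul 2)) i3, integral_add i1 (i2.const_mul 2),
            integral_const_mul,
            h.integral_mul_shock (X := fun ω => martPart k o ρ δ₀ v ω * path ρ δ₀ v t ω)
              (hmeas.mul (h.measurable_path ρ t)) i2,
            h.integral_mul_shock_sq ((h.measurable_path ρ t).pow_const 2) i3, ih,
            Finset.sum_range_succ]
          ring

/-- The product of two averages is handled through the fourth moments of the states and of the
sum of the shocks, with weights that balance their different orders `B ^ 2` and `m ^ 2`. -/
theorem integral_demeanPart_sq_le (h : IsIndividual μ ℱ δ₀ α v s C) {m o : ℕ} (hm : 0 < m)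
    {F B : ℝ} (hB : 0 < B)
    (hF : ∀ a < m, ∫ ω, path ρ δ₀ v (2 * a + (2 + o)) ω ^ 4 ∂μ ≤ F * B ^ 2) :
    ∫ ω, demeanPart m o ρ δ₀ v ω ^ 2 ∂μ ≤ (F + (8 * s ^ 2 + 3 * C)) * (m * B) := by
  have hm' : (0 : ℝ) < m := by exact_mod_cast hm
  have hV : MemLp (fun ω => ∑ b ∈ Finset.range m, v (2 * b + (2 + o) + 1) ω) 4 μ :=
    memLp_finsetSum _ fun _ _ => h.memLp_shock _
  have hV4 := h.integral_sum_shock_pow_four_le (2 + o) m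
  have hV0 : 0 ≤ ∫ ω, (∑ b ∈ Finset.range m, v (2 * b + (2 + o) + 1) ω) ^ 4 ∂μ :=
    integral_nonneg fun ω => by positivity
  simp only [demeanPart]
  refine integral_average_sq_le hm (fun a _ => h.memLp_demeanTerm m o a ρ) fun a ha => ?_
  have hy0 : 0 ≤ ∫ ω, path ρ δ₀ v (2 * a + (2 + o)) ω ^ 4 ∂μ :=
    integral_nonneg fun ω => by positivity
  refine (integral_mul_sq_le (h.memLp_path ρ _) hV (r := m / B) (by positivity)).trans ?_
  calc (m / B * ∫ ω, path ρ δ₀ v (2 * a + (2 + o)) ω ^ 4 ∂μ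
        + 1 / (m / B) * ∫ ω, (∑ b ∈ Finset.range m, v (2 * b + (2 + o) + 1) ω) ^ 4 ∂μ) / 2
      ≤ m / B * ∫ ω, path ρ δ₀ v (2 * a + (2 + o)) ω ^ 4 ∂μ
        + 1 / (m / B) * ∫ ω, (∑ b ∈ Finset.range m, v (2 * b + (2 + o) + 1) ω) ^ 4 ∂μ := by
        apply half_le_self; positivity
    _ ≤ m / B * (F * B ^ 2) + 1 / (m / B) * ((8 * s ^ 2 + 3 * C) * (m : ℝ) ^ 2) := by
        gcongr
        exact hF a ha
    _ = _ := by field_simp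

theorem integral_score_sq_le (h : IsIndividual μ ℱ δ₀ α v s C) {m : ℕ} (hm : 0 < m)
    {F B : ℝ} (hB : 0 < B) (hBm : B ≤ 2 * m + 2) (hF0 : 0 ≤ F)
    (hα : ∫ ω, α ω ^ 4 ∂μ ≤ F * B ^ 2)
    (hy2 : ∀ t ≤ 2 * m + 2, ∫ ω, path ρ δ₀ v t ω ^ 2 ∂μ ≤ F * B)
    (hy4 : ∀ t ≤ 2 * m + 2, ∫ ω, path ρ δ₀ v t ω ^ 4 ∂μ ≤ F * B ^ 2) :
    ∫ ω, score (2 * m + 2) ρ δ₀ α v ω ^ 2 ∂μ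
      ≤ 5 * (2 * (s * F) + 2 * (F + (8 * s ^ 2 + 3 * C)) + 288 * F) * ((2 * m + 2) * B) := by
  have hs := h.variance_nonneg
  have hC := h.fourth_moment_nonneg
  have i1 := (h.memLp_martPart m 1 ρ).integrable_sq
  have i2 := (h.memLp_martPart m 0 ρ).integrable_sq
  have i3 := (h.memLp_demeanPart m 1 ρ).integrable_sq
  have i4 := (h.memLp_demeanPart m 0 ρ).integrable_sq
  have i5 := (h.memLp_corr m ρ).integrable_sq
  have hm2 : (m : ℝ) * B ≤ (2 * m + 2) * B := by
    have : (0 : ℝ) ≤ m := Nat.cast_nonneg m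
    gcongr
    linarith
  have hmart : ∀ o ≤ 1, ∫ ω, martPart m o ρ δ₀ v ω ^ 2 ∂μ ≤ s * F * ((2 * m + 2) * B) := by
    intro o ho
    rw [h.integral_martPart_sq]
    calc s * ∑ a ∈ Finset.range m, ∫ ω, path ρ δ₀ v (2 * a + (2 + o)) ω ^ 2 ∂μ
        ≤ s * ∑ a ∈ Finset.range m, F * B := by
          gcongr with a ha
          have := Finset.mem_range.1 ha
          exact hy2 _ (by omega)
      _ = s * F * (m * B) := by simp; ring
      _ ≤ _ := by gcongr
  have hdem : ∀ o ≤ 1, ∫ ω, demeanPart m o ρ δ₀ v ω ^ 2 ∂μ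
      ≤ (F + (8 * s ^ 2 + 3 * C)) * ((2 * m + 2) * B) := by
    intro o ho
    refine (h.integral_demeanPart_sq_le hm hB fun a ha => hy4 _ (by omega)).trans ?_
    gcongr
  have hcorr : ∫ ω, (1 / (m : ℝ) * ∑ a ∈ Finset.range m, corrTerm a ρ δ₀ α v ω) ^ 2 ∂μ
      ≤ 288 * F * ((2 * m + 2) * B) := by
    refine (h.integral_corr_sq_le hm hα hy4).trans ?_
    calc 288 * (F * B ^ 2) = 288 * F * (B * B) := by ring
      _ ≤ _ := by gcongr
  calc ∫ ω, score (2 * m + 2) ρ δ₀ α v ω ^ 2 ∂μ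
      ≤ ∫ ω, 5 * (martPart m 1 ρ δ₀ v ω ^ 2 + martPart m 0 ρ δ₀ v ω ^ 2
          + demeanPart m 1 ρ δ₀ v ω ^ 2 + demeanPart m 0 ρ δ₀ v ω ^ 2
          + (1 / (m : ℝ) * ∑ a ∈ Finset.range m, corrTerm a ρ δ₀ α v ω) ^ 2) ∂μ := by
        refine integral_mono (h.memLp_score hm ρ).integrable_sq
          (((((i1.add i2).add i3).add i4).add i5).const_mul 5) fun ω => ?_
        simp only [score_eq hm]
        set p := martPart m 1 ρ δ₀ v ω
        set q := martPart m 0 ρ δ₀ v ω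
        set r := demeanPart m 1 ρ δ₀ v ω
        set u := demeanPart m 0 ρ δ₀ v ω
        set w := 1 / (m : ℝ) * ∑ a ∈ Finset.range m, corrTerm a ρ δ₀ α v ω
        -- Cauchy–Schwarz for five summands, as a sum of squares of pairwise differences.
        have hid : 5 * (p ^ 2 + q ^ 2 + r ^ 2 + u ^ 2 + w ^ 2) - (p + q - r - u + w) ^ 2
            = (p - q) ^ 2 + (p + r) ^ 2 + (p + u) ^ 2 + (p - w) ^ 2 + (q + r) ^ 2 + (q + u) ^ 2
              + (q - w) ^ 2 + (r - u) ^ 2 + (r + w) ^ 2 + (u + w) ^ 2 := by ring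
        have hpos : 0 ≤ (p - q) ^ 2 + (p + r) ^ 2 + (p + u) ^ 2 + (p - w) ^ 2 + (q + r) ^ 2
              + (q + u) ^ 2 + (q - w) ^ 2 + (r - u) ^ 2 + (r + w) ^ 2 + (u + w) ^ 2 := by
          positivity
        linarith
    _ ≤ _ := by
        rw [integral_const_mul, integral_add (((i1.fun_add i2).fun_add i3).fun_add i4) i5,
          integral_add ((i1.fun_add i2).fun_add i3) i4, integral_add (i1.fun_add i2) i3,
          integral_add i1 i2]
        have h1 := hmart 1 le_rfl
        have h2 := hmart 0 zero_le_one
        have h3 := hdem 1 le_rfl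
        have h4 := hdem 0 zero_le_one
        linarith

/-! ### Moments of the denominator -/

/-- A lower bound for the mean of the denominator: the first and the last third of the even times
are at least `2 (m / 3)` periods apart. -/
theorem le_integral_info (h : IsIndividual μ ℱ δ₀ α v s C) {m : ℕ} (hm : 3 ≤ m) :
    s / 72 * m * ∑ j ∈ Finset.range (2 * (m / 3)), ρ ^ (2 * j)
      ≤ ∫ ω, info (2 * m + 2) ρ δ₀ α v ω ∂μ := by
  have hm0 : 0 < m := by omega
  have hm' : (0 : ℝ) < m := by exact_mod_cast hm0
  have hs := h.variance_nonneg
  set q := m / 3 with hq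
  set Q := ∑ j ∈ Finset.range (2 * q), ρ ^ (2 * j) with hQ
  have hQ0 : 0 ≤ Q := Finset.sum_nonneg fun j _ => by rw [pow_mul]; positivity
  have hqm : (m : ℝ) / 6 ≤ q := by
    have : m ≤ 6 * q := by omega
    have : (m : ℝ) ≤ 6 * q := by exact_mod_cast this
    linarith
  have hi : ∀ a b, Integrable
      (fun ω => (path ρ δ₀ v (2 * a + 2) ω - path ρ δ₀ v (2 * b + 2) ω) ^ 2) μ :=
    fun a b => integrable_sq_of_memLp_four ((h.memLp_path ρ _).sub (h.memLp_path ρ _))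
  have hpair : ∀ a ∈ Finset.range q, ∀ b ∈ Finset.Ico (m - q) m,
      s * Q ≤ ∫ ω, (path ρ δ₀ v (2 * a + 2) ω - path ρ δ₀ v (2 * b + 2) ω) ^ 2 ∂μ := by
    intro a ha b hb
    have ha' := Finset.mem_range.1 ha
    have hb' := Finset.mem_Ico.1 hb
    have h1 := h.le_integral_path_sub_sq (ρ := ρ) (2 * a + 2) (2 * (b - a))
    rw [show 2 * a + 2 + 2 * (b - a) = 2 * b + 2 by omega] at h1
    refine le_trans ?_ h1
    gcongr
    refine Finset.sum_le_sum_of_subset_of_nonneg (Finset.range_mono (by omega)) fun j _ _ => ?_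
    rw [pow_mul]; positivity
  have hsumsq : Integrable (fun ω => sumSq m (fun a => path ρ δ₀ v (2 * a + 2) ω)) μ :=
    (h.memLp_sumSq 2 ρ).integrable (by norm_num)
  have hcard : (Finset.Ico (m - q) m).card = q := by rw [Nat.card_Ico]; omega
  calc s / 72 * m * Q = 1 / (2 * (m : ℝ)) * ((m / 6) * ((m / 6) * (s * Q))) := by
        field_simp; ring
    _ ≤ 1 / (2 * (m : ℝ)) * (q * (q * (s * Q))) := by gcongr
    _ = 1 / (2 * (m : ℝ)) * ∑ a ∈ Finset.range q, ∑ b ∈ Finset.Ico (m - q) m, s * Q := by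
        simp [hcard]
    _ ≤ 1 / (2 * (m : ℝ)) * ∑ a ∈ Finset.range q, ∑ b ∈ Finset.Ico (m - q) m,
          ∫ ω, (path ρ δ₀ v (2 * a + 2) ω - path ρ δ₀ v (2 * b + 2) ω) ^ 2 ∂μ := by
        gcongr with a ha b hb
        exact hpair a ha b hb
    _ ≤ 1 / (2 * (m : ℝ)) * ∑ a ∈ Finset.range m, ∑ b ∈ Finset.range m,
          ∫ ω, (path ρ δ₀ v (2 * a + 2) ω - path ρ δ₀ v (2 * b + 2) ω) ^ 2 ∂μ := by
        have hnn : ∀ a b, 0 ≤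
            ∫ ω, (path ρ δ₀ v (2 * a + 2) ω - path ρ δ₀ v (2 * b + 2) ω) ^ 2 ∂μ :=
          fun a b => integral_nonneg fun ω => sq_nonneg _
        refine mul_le_mul_of_nonneg_left ?_ (by positivity)
        refine (Finset.sum_le_sum fun a _ => ?_).trans
          (Finset.sum_le_sum_of_subset_of_nonneg (Finset.range_mono (by omega))
            fun a _ _ => Finset.sum_nonneg fun b _ => hnn a b)
        refine Finset.sum_le_sum_of_subset_of_nonneg (fun b hb => ?_) fun b _ _ => hnn a b
        exact Finset.mem_range.2 (Finset.mem_Ico.1 hb).2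
    _ = ∫ ω, sumSq m (fun a => path ρ δ₀ v (2 * a + 2) ω) ∂μ := by
        simp only [sumSq_eq_pairs m hm0]
        rw [integral_const_mul, integral_finsetSum _ fun a _ =>
          integrable_finsetSum _ fun b _ => hi a b]
        congr 1
        refine Finset.sum_congr rfl fun a _ => ?_
        rw [integral_finsetSum _ fun b _ => hi a b]
    _ ≤ _ := by
        refine integral_mono hsumsq ((h.memLp_info hm0 ρ).integrable (by norm_num)) fun ω => ?_
        simp only [info_eq hm0]
        linarith [sumSq_nonneg m (fun a => path ρ δ₀ v (2 * a + 3) ω)]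

end IsIndividual

/-! ### The moments of one individual along the sample length -/

open IsIndividual

section Assumptions

variable {Ω : Type*} [m0 : MeasurableSpace Ω] {μ : Measure Ω} {c γ : ℝ}
  {δ₀ α : ℕ → ℕ → Ω → ℝ} {w : ℕ → ℕ → Ω → Plane} {Ωstar : Matrix (Fin 2) (Fin 2) ℝ}

/-- The sigma-fields `past` of one individual form a filtration. -/
def pastFiltration {δ₀ α : Ω → ℝ} {w : ℕ → Ω → Plane} (hδ : Measurable δ₀) (hα : Measurable α)
    (hw : ∀ t, Measurable (w t)) : Filtration ℕ m0 where
  seq := past δ₀ α w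
  mono' r t hrt := by
    refine sup_le_sup le_rfl (biSup_mono fun u hu => ?_)
    exact ⟨hu.1, hu.2.trans hrt⟩
  le' t := sup_le (sup_le hδ.comap_le hα.comap_le) (iSup₂_le fun u _ => (hw u).comap_le)

theorem Innovations.memLp_shock (hw : Innovations μ δ₀ α w Ωstar) (i t : ℕ) :
    MemLp (w i (t + 1)) 4 μ := by
  obtain ⟨C, hC⟩ := hw.fourth_moment
  rw [← integrable_norm_rpow_iff (hw.measurable_shock i (t + 1)).aestronglyMeasurable
    (by norm_num) (by norm_num)]
  refine (hC i (t + 1) (by omega)).1.congr (Eventually.of_forall fun ω => ?_)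
  have : (4 : ENNReal).toReal = ((4 : ℕ) : ℝ) := by norm_num
  simp only [this, Real.rpow_natCast]

/-- The constant bounding the fourth moments of the shocks does not depend on the individual or on
the sample length. -/
theorem Innovations.exists_isIndividual [IsProbabilityMeasure μ]
    (hinit : InitialValues μ c γ δ₀ α) (hw : Innovations μ δ₀ α w Ωstar) :
    ∃ C : ℝ, ∀ T i, ∃ ℱ : Filtration ℕ m0,
      IsIndividual μ ℱ (δ₀ T i) (α T i) (fun t ω => w i t ω 1) (Ωstar 1 1) C := by
  obtain ⟨C, hC⟩ := hw.fourth_moment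
  have hvL : ∀ i t, MemLp (fun ω => w i (t + 1) ω 1) 4 μ := fun i t =>
    (EuclideanSpace.proj (𝕜 := ℝ) (1 : Fin 2)).comp_memLp' (hw.memLp_shock i t)
  refine ⟨C, fun T i => ⟨pastFiltration (hinit.measurable_init T i) (hinit.measurable_drift T i)
    (hw.measurable_shock i), ?_⟩⟩
  refine
    { measurable_init := ?_
      measurable_drift := ?_
      memLp_init := hinit.memLp_init T i
      memLp_drift := hinit.memLp_drift T i
      uncorrelated := ?_
      measurable_shock := fun t => ?_
      memLp_shock := hvL i
      fourth_moment_shock := fun t => ?_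
      condExp_shock := fun t => ?_
      condExp_shock_sq := fun t => ?_ }
  · exact (comap_measurable (δ₀ T i)).mono (le_sup_left.trans le_sup_left) le_rfl
  · exact (comap_measurable (α T i)).mono (le_sup_right.trans le_sup_left) le_rfl
  · have hle := (hinit.measurable_drift T i).comap_le
    have hi := integrable_mul_of_memLp_four (hinit.memLp_drift T i) (hinit.memLp_init T i)
    have h1 := condExp_mul_of_stronglyMeasurable_left
      (m := MeasurableSpace.comap (α T i) inferInstance)
      (comap_measurable (α T i)).stronglyMeasurable hi
      ((hinit.memLp_init T i).integrable (by norm_num))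
    rw [← integral_condExp hle]
    refine integral_eq_zero_of_ae ?_
    filter_upwards [h1, hinit.condExp_init T i] with ω h2 h3
    refine h2.trans ?_
    simp [h3]
  · have h1 : Measurable[past (δ₀ T i) (α T i) (w i) (t + 1)] (w i (t + 1)) :=
      (comap_measurable (w i (t + 1))).mono
        ((le_biSup (fun r => MeasurableSpace.comap (w i r) inferInstance)
          (show t + 1 ∈ Set.Icc 1 (t + 1) from ⟨by omega, le_rfl⟩)).trans le_sup_right) le_rfl
    exact (EuclideanSpace.proj (𝕜 := ℝ) (1 : Fin 2)).continuous.measurable.comp h1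
  · obtain ⟨h1, h2⟩ := hC i (t + 1) (by omega)
    refine le_trans (integral_mono (integrable_pow_four (hvL i t)) h1 fun ω => ?_) h2.le
    simp only
    rw [← Even.pow_abs (show Even 4 by decide)]
    exact pow_le_pow_left₀ (abs_nonneg _) (PiLp.norm_apply_le (w i (t + 1) ω) 1) 4
  · have h1 := (EuclideanSpace.proj (𝕜 := ℝ) (1 : Fin 2)).comp_condExp_comm
      (m := past (δ₀ T i) (α T i) (w i) t) ((hw.memLp_shock i t).integrable (by norm_num))
    filter_upwards [h1, hw.martingale_diff T i t] with ω h2 h3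
    refine h2.symm.trans ?_
    simp [h3]
  · have h1 := hw.cond_cov T i t 1 1
    simp only [← sq] at h1
    exact h1

/-- Bounds, uniform over individuals and over large even sample lengths, for the moments of the
contributions to the numerator and to the denominator. -/
theorem exists_moment_bounds [IsProbabilityMeasure μ] (hcγ : Admissible c γ)
    (hinit : InitialValues μ c γ δ₀ α) (hw : Innovations μ δ₀ α w Ωstar) :
    ∃ K κ : ℝ, 0 < K ∧ 0 < κ ∧ ∀ᶠ T : ℕ in atTop, Even T → ∀ i,
      MemLp (score T (rhoStar c γ T) (δ₀ T i) (α T i) (fun t ω => w i t ω 1)) 2 μ ∧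
      MemLp (info T (rhoStar c γ T) (δ₀ T i) (α T i) (fun t ω => w i t ω 1)) 2 μ ∧
      ∫ ω, score T (rhoStar c γ T) (δ₀ T i) (α T i) (fun t ω => w i t ω 1) ω ^ 2 ∂μ
        ≤ K * (T : ℝ) ^ (1 + γ) ∧
      |∫ ω, score T (rhoStar c γ T) (δ₀ T i) (α T i) (fun t ω => w i t ω 1) ω ∂μ|
        ≤ K * ((T : ℝ) ^ (1 + γ) / (T : ℝ) ^ 2) ∧
      ∫ ω, info T (rhoStar c γ T) (δ₀ T i) (α T i) (fun t ω => w i t ω 1) ω ^ 2 ∂μ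
        ≤ K * ((T : ℝ) ^ (1 + γ)) ^ 2 ∧
      κ * (T : ℝ) ^ (1 + γ)
        ≤ ∫ ω, info T (rhoStar c γ T) (δ₀ T i) (α T i) (fun t ω => w i t ω 1) ω ∂μ := by
  obtain ⟨C₀, hind⟩ := hw.exists_isIndividual hinit
  obtain ⟨hγ0, hγ1⟩ := hcγ.mem_Icc
  obtain ⟨K, hK1, hup⟩ := hcγ.exists_upper_bounds
  obtain ⟨κ, hκ, hlow⟩ := hcγ.exists_lower_bound
  obtain ⟨K', hK', hmin⟩ := hcγ.exists_invMin_le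
  obtain ⟨C, hfour⟩ := hinit.fourth_moment
  set s := Ωstar 1 1
  have hs : 0 < s := hw.posDef.diag_pos
  have hC₀ : 0 ≤ C₀ := by
    obtain ⟨_, h⟩ := hind 0 0
    exact h.fourth_moment_nonneg
  set L := |C| * K' + 1 with hL
  have hL1 : 1 ≤ L := by
    have : 0 ≤ |C| * K' := by positivity
    linarith
  set F := max (max ((L + s) * K) (stateConst s C₀ K L)) L
  have hFL : L ≤ F := le_max_right _ _
  have hF2 : (L + s) * K ≤ F := (le_max_left _ _).trans (le_max_left _ _)
  have hF4 : stateConst s C₀ K L ≤ F := (le_max_right _ _).trans (le_max_left _ _)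
  have hF0 : 0 < F := by linarith
  set Z := 5 * (2 * (s * F) + 2 * (F + (8 * s ^ 2 + 3 * C₀)) + 288 * F)
  have hZ : 0 < Z := by positivity
  have hZle : Z ≤ Z + F + 4 * s * K := by nlinarith
  refine ⟨Z + F + 4 * s * K, s / 288 * κ, by positivity, by positivity, ?_⟩
  filter_upwards [hup, hlow, hfour, eventually_ge_atTop 8] with T hupT hlowT hfourT hT8 hTe i
  obtain ⟨hpow, hQ⟩ := hupT
  obtain ⟨m, rfl⟩ : ∃ m, T = 2 * m + 2 := by
    obtain ⟨r, hr⟩ := hTe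
    exact ⟨r - 1, by omega⟩
  have hm3 : 3 ≤ m := by omega
  have hm0 : 0 < m := by omega
  have hm' : (0 : ℝ) < m := by exact_mod_cast hm0
  obtain ⟨ℱ, h⟩ := hind (2 * m + 2) i
  have hTcast : ((2 * m + 2 : ℕ) : ℝ) = 2 * m + 2 := by push_cast; ring
  have hT1 : (1 : ℝ) ≤ ((2 * m + 2 : ℕ) : ℝ) := by rw [hTcast]; linarith
  have hT0 : (0 : ℝ) < ((2 * m + 2 : ℕ) : ℝ) := by linarith
  have hpowS : ((2 * m + 2 : ℕ) : ℝ) ^ (1 + γ)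
      = (2 * m + 2) * ((2 * m + 2 : ℕ) : ℝ) ^ γ := by
    rw [Real.rpow_add hT0, Real.rpow_one, hTcast]
  have hB1 : 1 ≤ ((2 * m + 2 : ℕ) : ℝ) ^ γ := Real.one_le_rpow hT1 hγ0
  have hBT : ((2 * m + 2 : ℕ) : ℝ) ^ γ ≤ 2 * m + 2 := by
    rw [← hTcast]
    simpa using Real.rpow_le_rpow_of_exponent_le hT1 hγ1
  have hminT := hmin (2 * m + 2) (by omega)
  have hfi := hfourT i
  rw [hpowS]
  set ρ := rhoStar c γ (2 * m + 2)
  set B := ((2 * m + 2 : ℕ) : ℝ) ^ γ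
  have hB0 : 0 < B := by linarith
  have hsum4 : ∫ ω, δ₀ (2 * m + 2) i ω ^ 4 ∂μ + ∫ ω, α (2 * m + 2) i ω ^ 4 ∂μ ≤ L * B ^ 2 := by
    rw [← integral_add (integrable_pow_four h.memLp_init) (integrable_pow_four h.memLp_drift)]
    calc _ ≤ C * invMin (|1 - ρ| ^ 2) (((2 * m + 2 : ℕ) : ℝ) ^ 2) := hfi
      _ ≤ |C| * (K' * B ^ 2) :=
          mul_le_mul (le_abs_self C) hminT.2 hminT.1 (abs_nonneg C)
      _ ≤ L * B ^ 2 := by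
          rw [← mul_assoc, hL]
          gcongr
          linarith
  have hδ0 : 0 ≤ ∫ ω, δ₀ (2 * m + 2) i ω ^ 4 ∂μ := integral_nonneg fun ω => by positivity
  have hα0 : 0 ≤ ∫ ω, α (2 * m + 2) i ω ^ 4 ∂μ := integral_nonneg fun ω => by positivity
  have hδ4 : ∫ ω, δ₀ (2 * m + 2) i ω ^ 4 ∂μ ≤ L * B ^ 2 := by linarith
  have hα4 : ∫ ω, α (2 * m + 2) i ω ^ 4 ∂μ ≤ F * B ^ 2 :=
    (show _ ≤ L * B ^ 2 by linarith).trans (by gcongr)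
  -- The second moment is controlled by the fourth.
  have hδ2 : ∫ ω, δ₀ (2 * m + 2) i ω ^ 2 ∂μ ≤ L * B := by
    have h1 := integral_mul_sq_le h.memLp_init (memLp_const (μ := μ) (p := 4) (1 : ℝ))
      (r := 1 / B) (by positivity)
    simp only [mul_one, one_pow, integral_const, probReal_univ, smul_eq_mul, one_div_one_div] at h1
    have h2 : 1 / B * ∫ ω, δ₀ (2 * m + 2) i ω ^ 4 ∂μ ≤ L * B := by
      calc _ ≤ 1 / B * (L * B ^ 2) := by gcongr
        _ = _ := by field_simp
    nlinarith
  have hy2 : ∀ t ≤ 2 * m + 2,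
      ∫ ω, path ρ (δ₀ (2 * m + 2) i) (fun t ω => w i t ω 1) t ω ^ 2 ∂μ ≤ F * B := fun t ht =>
    (h.integral_path_sq_le hδ2 hpow hQ ht).trans (by gcongr)
  have hy4 : ∀ t ≤ 2 * m + 2,
      ∫ ω, path ρ (δ₀ (2 * m + 2) i) (fun t ω => w i t ω 1) t ω ^ 4 ∂μ ≤ F * B ^ 2 := fun t ht =>
    (h.integral_path_pow_four_le (by linarith) hB1 hK1 hδ2 hδ4 hpow hQ ht).trans (by gcongr)
  refine ⟨h.memLp_score hm0 ρ, h.memLp_info hm0 ρ, ?_, ?_, ?_, ?_⟩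
  · refine (h.integral_score_sq_le hm0 hB0 hBT hF0.le hα4 hy2 hy4).trans ?_
    gcongr
  · have hQm : ∑ j ∈ Finset.range m, ρ ^ (2 * j) ≤ K * B :=
      (Finset.sum_le_sum_of_subset_of_nonneg (Finset.range_mono (by omega))
        fun j _ _ => by rw [pow_mul]; positivity).trans hQ
    calc _ ≤ s / m * ∑ j ∈ Finset.range m, ρ ^ (2 * j) := h.abs_integral_score_le hm0
      _ ≤ s / m * (K * B) := by gcongr
      _ = s * K * B * (1 / m) := by ring
      _ ≤ s * K * B * (4 / (2 * m + 2)) := by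
          refine mul_le_mul_of_nonneg_left ?_ (by positivity)
          rw [div_le_div_iff₀ hm' (by positivity)]
          have : (3 : ℝ) ≤ m := by exact_mod_cast hm3
          linarith
      _ = 4 * s * K * ((2 * m + 2) * B / (2 * m + 2) ^ 2) := by field_simp
      _ ≤ _ := by
          rw [hTcast]
          gcongr
          linarith
  · refine (h.integral_info_sq_le hm0 hy4).trans ?_
    calc F * B ^ 2 * (2 * (m : ℝ) + 2) ^ 2 = F * ((2 * m + 2) * B) ^ 2 := by ring
      _ ≤ _ := by
          gcongr
          have : 0 < 4 * s * K := by positivity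
          linarith
  · refine le_trans ?_ (h.le_integral_info hm3)
    have h1 := hlowT (2 * (m / 3)) (by omega)
    calc s / 288 * κ * ((2 * m + 2) * B) = s / 72 * ((2 * m + 2) / 4) * (κ * B) := by ring
      _ ≤ s / 72 * m * (κ * B) := by
          have : (3 : ℝ) ≤ m := by exact_mod_cast hm3
          gcongr
          linarith
      _ ≤ _ := by gcongr

end Assumptions

/-! ### Independence across individuals -/

theorem state_congr (ρ d : ℝ) {u v : ℕ → ℝ} (h : ∀ t, u (t + 1) = v (t + 1)) (t : ℕ) :
    state ρ d u t = state ρ d v t := by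
  induction t with
  | zero => rfl
  | succ t ih => simp only [state, ih, h]

/-- The observables as a function of initial value, drift and the sequence of shocks
`w 1, w 2, …`, in which `w t` has index `t - 1`. -/
noncomputable def obsOf (ρ : ℝ) (p : ℝ × ℝ × (ℕ → Plane)) (t : ℕ) : ℝ :=
  observable ρ p.2.1 p.1 (fun r => p.2.2 (r - 1) 1) t

theorem measurable_obsOf (ρ : ℝ) (t : ℕ) : Measurable fun p => obsOf ρ p t := by
  have hproj : Measurable fun x : Plane => x 1 :=
    (EuclideanSpace.proj (𝕜 := ℝ) (1 : Fin 2)).continuous.measurable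
  have hstate : Measurable fun p : ℝ × ℝ × (ℕ → Plane) =>
      state ρ p.1 (fun r => p.2.2 (r - 1) 1) t := by
    induction t with
    | zero => exact measurable_fst
    | succ t ih =>
      exact (ih.const_mul ρ).add
        (hproj.comp ((measurable_pi_apply _).comp (measurable_snd.comp measurable_snd)))
  exact (measurable_fst.comp measurable_snd).add hstate

theorem measurable_denom_obsOf (T : ℕ) (ρ : ℝ) : Measurable fun p => denom T (obsOf ρ p) := by
  have := measurable_obsOf ρ
  unfold denom demean
  fun_prop

theorem measurable_numer_obsOf (T : ℕ) (ρ : ℝ) : Measurable fun p => numer T (obsOf ρ p) := by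
  have := measurable_obsOf ρ
  unfold numer eta demean
  fun_prop

theorem obsOf_eq {Ω : Type*} (ρ : ℝ) (δ₀ α : Ω → ℝ) (w : ℕ → Ω → Plane) (ω : Ω) :
    obsOf ρ (δ₀ ω, α ω, fun t => w (t + 1) ω) = fun t => obs ρ δ₀ α (fun t ω => w t ω 1) t ω := by
  funext t
  simp only [obsOf, obs, observable]
  rw [state_congr ρ (δ₀ ω) (v := fun r => w r ω 1) fun r => by simp only [Nat.add_sub_cancel]]

section Independence

variable {Ω : Type*} [MeasurableSpace Ω] {μ : Measure Ω}
  {δ₀ α : ℕ → ℕ → Ω → ℝ} {w : ℕ → ℕ → Ω → Plane} {Ωstar : Matrix (Fin 2) (Fin 2) ℝ}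

theorem Innovations.iIndepFun_info (hw : Innovations μ δ₀ α w Ωstar) (T : ℕ) (ρ : ℝ) :
    iIndepFun (fun i => info T ρ (δ₀ T i) (α T i) (fun t ω => w i t ω 1)) μ := by
  have := (hw.indep T).comp (fun _ p => denom T (obsOf ρ p)) fun _ => measurable_denom_obsOf T ρ
  simp only [Function.comp_def, obsOf_eq] at this
  exact this

theorem Innovations.iIndepFun_score (hw : Innovations μ δ₀ α w Ωstar) (T : ℕ) (ρ : ℝ) :
    iIndepFun (fun i => score T ρ (δ₀ T i) (α T i) (fun t ω => w i t ω 1)) μ := by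
  have := (hw.indep T).comp (fun _ p => numer T (obsOf ρ p) - ρ * denom T (obsOf ρ p))
    fun _ => (measurable_numer_obsOf T ρ).sub ((measurable_denom_obsOf T ρ).const_mul ρ)
  simp only [Function.comp_def, obsOf_eq] at this
  exact this

end Independence

/-! ### Ratios of sums of independent variables -/

section Ratio

variable {Ω : Type*} [MeasurableSpace Ω] {μ : Measure Ω} [IsProbabilityMeasure μ]

/-- Chebyshev's inequality for a sum of independent variables with bounded second moments. -/
theorem measureReal_sum_sub_le {X : ℕ → Ω → ℝ} (hX : iIndepFun X μ) (h2 : ∀ i, MemLp (X i) 2 μ)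
    {b : ℝ} (hb : ∀ i, ∫ ω, X i ω ^ 2 ∂μ ≤ b) (n : ℕ) {r : ℝ} (hr : 0 < r) :
    μ.real {ω | r ≤ |∑ i ∈ Finset.range n, X i ω - ∑ i ∈ Finset.range n, ∫ ω, X i ω ∂μ|}
      ≤ n * b / r ^ 2 := by
  have hsum : MemLp (∑ i ∈ Finset.range n, X i) 2 μ := memLp_finsetSum' _ fun i _ => h2 i
  have hvar : variance (∑ i ∈ Finset.range n, X i) μ ≤ n * b := by
    rw [IndepFun.variance_sum (fun i _ => h2 i) fun i _ j _ hij => hX.indepFun hij]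
    calc _ ≤ ∑ i ∈ Finset.range n, b := Finset.sum_le_sum fun i _ =>
          (variance_le_expectation_sq (h2 i).1).trans (hb i)
      _ = _ := by simp
  have hint : μ[∑ i ∈ Finset.range n, X i] = ∑ i ∈ Finset.range n, ∫ ω, X i ω ∂μ := by
    simp only [Finset.sum_apply]
    exact integral_finsetSum _ fun i _ => (h2 i).integrable (by norm_num)
  have h1 := meas_ge_le_variance_div_sq hsum hr
  rw [hint] at h1
  simp only [Finset.sum_apply] at h1
  refine (ENNReal.toReal_le_of_le_ofReal (div_nonneg (variance_nonneg _ _) (sq_nonneg r)) h1).trans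
    ?_
  gcongr

/-- Tail bound for the ratio `Z` of two sums of independent variables (`Z` is arbitrary where the
denominator vanishes), the summands of the denominator
being of exact order `S` in mean and at most of order `S` in `L²`, and those of the numerator of
order `√S` in `L²` with mean at most `K S q`. -/
theorem measureReal_ratio_le {X Y : ℕ → Ω → ℝ} (hX : iIndepFun X μ) (hY : iIndepFun Y μ)
    (hX2 : ∀ i, MemLp (X i) 2 μ) (hY2 : ∀ i, MemLp (Y i) 2 μ) {K κ S q L : ℝ} (hK : 0 < K)
    (hκ : 0 < κ) (hS : 0 < S) (hq : 0 ≤ q) (hL : 0 < L)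
    (hXsq : ∀ i, ∫ ω, X i ω ^ 2 ∂μ ≤ K * S) (hXmean : ∀ i, |∫ ω, X i ω ∂μ| ≤ K * (S * q))
    (hYsq : ∀ i, ∫ ω, Y i ω ^ 2 ∂μ ≤ K * S ^ 2) (hYmean : ∀ i, κ * S ≤ ∫ ω, Y i ω ∂μ)
    {n : ℕ} (hn : 0 < n) {Z : Ω → ℝ}
    (hZ : ∀ ω, ∑ i ∈ Finset.range n, Y i ω ≠ 0 →
      Z ω = (∑ i ∈ Finset.range n, X i ω) / ∑ i ∈ Finset.range n, Y i ω) :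
    μ.real {ω | 2 / κ * (L + K) * (1 / √(n * S) + q) < |Z ω|}
      ≤ K / L ^ 2 + 4 * K / (κ ^ 2 * n) := by
  have hn' : (0 : ℝ) < n := by exact_mod_cast hn
  have hnS : 0 < (n : ℝ) * S := by positivity
  have hsq : √((n : ℝ) * S) ^ 2 = n * S := Real.sq_sqrt hnS.le
  have hsp : 0 < √((n : ℝ) * S) := Real.sqrt_pos.2 hnS
  have h1 := measureReal_sum_sub_le hX hX2 hXsq n (r := L * √(n * S)) (by positivity)
  have h2 := measureReal_sum_sub_le hY hY2 hYsq n (r := κ * (n * S) / 2) (by positivity)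
  have e1 : (n : ℝ) * (K * S) / (L * √(n * S)) ^ 2 = K / L ^ 2 := by
    rw [mul_pow, hsq]; field_simp
  have e2 : (n : ℝ) * (K * S ^ 2) / (κ * (n * S) / 2) ^ 2 = 4 * K / (κ ^ 2 * n) := by
    field_simp; norm_num
  rw [e1] at h1
  rw [e2] at h2
  refine le_trans ?_ (add_le_add h1 h2)
  refine le_trans (measureReal_mono ?_) (measureReal_union_le _ _)
  intro ω hω
  by_contra hcon
  simp only [Set.mem_union, Set.mem_ofPred_eq, not_or, not_le] at hcon hω
  obtain ⟨hA, hD⟩ := hcon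
  have hYm : κ * (n * S) ≤ ∑ i ∈ Finset.range n, ∫ ω, Y i ω ∂μ := by
    calc κ * (n * S) = ∑ i ∈ Finset.range n, κ * S := by simp; ring
      _ ≤ _ := Finset.sum_le_sum fun i _ => hYmean i
  have hXm : |∑ i ∈ Finset.range n, ∫ ω, X i ω ∂μ| ≤ K * (n * S * q) := by
    calc _ ≤ ∑ i ∈ Finset.range n, |∫ ω, X i ω ∂μ| := Finset.abs_sum_le_sum_abs _ _
      _ ≤ ∑ i ∈ Finset.range n, K * (S * q) := Finset.sum_le_sum fun i _ => hXmean i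
      _ = _ := by simp; ring
  have hYlow : κ * (n * S) / 2 ≤ ∑ i ∈ Finset.range n, Y i ω := by
    have := (abs_lt.1 hD).1
    linarith
  have hYpos : 0 < ∑ i ∈ Finset.range n, Y i ω := lt_of_lt_of_le (by positivity) hYlow
  have hXup : |∑ i ∈ Finset.range n, X i ω| ≤ L * √(n * S) + K * (n * S * q) := by
    have h3 := abs_add_le
      (∑ i ∈ Finset.range n, X i ω - ∑ i ∈ Finset.range n, ∫ ω, X i ω ∂μ)
      (∑ i ∈ Finset.range n, ∫ ω, X i ω ∂μ)
    rw [sub_add_cancel] at h3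
    linarith
  refine absurd hω (not_lt.2 ?_)
  rw [hZ ω hYpos.ne', abs_div, abs_of_pos hYpos, div_le_iff₀ hYpos]
  have hroot : n * S * (1 / √(n * S)) = √((n : ℝ) * S) := by
    rw [mul_one_div, div_eq_iff hsp.ne', ← sq, hsq]
  calc |∑ i ∈ Finset.range n, X i ω| ≤ L * √(n * S) + K * (n * S * q) := hXup
    _ ≤ (L + K) * (√(n * S) + n * S * q) := by
        have h4 : 0 ≤ (n : ℝ) * S * q := by positivity
        nlinarith [mul_nonneg hL.le h4, mul_nonneg hK.le hsp.le]
    _ = 2 / κ * (L + K) * (1 / √(n * S) + q) * (κ * (n * S) / 2) := by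
        have hk : 2 / κ * (κ / 2) = 1 := by field_simp
        linear_combination (-(L + K) * (n * S) * (1 / √(n * S) + q)) * hk - (L + K) * hroot
    _ ≤ _ := by gcongr

end Ratio

theorem estimator_sub {n T : ℕ} (x : ℕ → ℕ → ℝ) (ρ : ℝ)
    (h : ∑ i ∈ Finset.range n, denom T (x i) ≠ 0) :
    estimator n T x - ρ = (∑ i ∈ Finset.range n, (numer T (x i) - ρ * denom T (x i)))
      / ∑ i ∈ Finset.range n, denom T (x i) := by
  rw [Finset.sum_sub_distrib, ← Finset.mul_sum, sub_div, mul_div_cancel_right₀ _ h]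
  rfl

end XJ

theorem mainTheorem2 {Ω : Type*} [MeasurableSpace Ω] (μ : Measure Ω) [IsProbabilityMeasure μ]
    (c γ : ℝ) (hcγ : XJ.Admissible c γ)
    (δ₀ α : ℕ → ℕ → Ω → ℝ) (w : ℕ → ℕ → Ω → XJ.Plane) (Ωstar : Matrix (Fin 2) (Fin 2) ℝ)
    (hinit : XJ.InitialValues μ c γ δ₀ α)
    (hinnov : XJ.Innovations μ δ₀ α w Ωstar) :
    XJ.IsBigOp μ XJ.jointLimit
      (fun p ω =>
        XJ.estimator p.1 p.2
          (fun i => XJ.observable (XJ.rhoStar c γ p.2) (α p.2 i ω) (δ₀ p.2 i ω)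
            (fun t => w i t ω 1))
          - XJ.rhoStar c γ p.2)
      (fun p => 1 / √((p.1 : ℝ) * (p.2 : ℝ) ^ (1 + γ)) + 1 / (p.2 : ℝ) ^ 2) := by
  intro ε hε
  obtain ⟨K, κ, hK, hκ, hev⟩ := XJ.exists_moment_bounds hcγ hinit hinnov
  -- The two error probabilities of `measureReal_ratio_le` are each at most `ε / 2` for this choice
  -- of `L` and for `n ≥ 8 K / (κ² ε)`.
  set L := √(2 * K / ε) with hL
  have hL0 : 0 < L := Real.sqrt_pos.2 (by positivity)
  have hL2 : K / L ^ 2 = ε / 2 := by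
    rw [hL, Real.sq_sqrt (by positivity)]
    field_simp
  refine ⟨2 / κ * (L + K), ?_⟩
  have hn : ∀ᶠ n : ℕ in atTop, 8 * K / (κ ^ 2 * ε) ≤ n ∧ 0 < n :=
    (tendsto_natCast_atTop_atTop.eventually_ge_atTop _).and (eventually_gt_atTop 0)
  have hT : ∀ᶠ T : ℕ in atTop ⊓ 𝓟 {T | Even T}, 0 < T ∧ _ :=
    ((eventually_gt_atTop 0).filter_mono inf_le_left).and (eventually_inf_principal.2 hev)
  refine (hn.prod_mk hT).mono ?_
  rintro ⟨n, T⟩ ⟨⟨hnK, hn0⟩, hT0, hb⟩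
  simp only at hnK hn0 hT0 hb ⊢
  have hn' : (0 : ℝ) < n := by exact_mod_cast hn0
  have hT' : (0 : ℝ) < T := by exact_mod_cast hT0
  refine (XJ.measureReal_ratio_le (hinnov.iIndepFun_score T _) (hinnov.iIndepFun_info T _)
    (fun i => (hb i).1) (fun i => (hb i).2.1) hK hκ (S := (T : ℝ) ^ (1 + γ))
    (q := 1 / (T : ℝ) ^ 2) (by positivity) (by positivity) hL0 (fun i => (hb i).2.2.1)
    (fun i => by rw [mul_one_div]; exact (hb i).2.2.2.1) (fun i => (hb i).2.2.2.2.1)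
    (fun i => (hb i).2.2.2.2.2) hn0 fun ω hω => XJ.estimator_sub _ _ hω).trans ?_
  have h2 : 4 * K / (κ ^ 2 * n) ≤ ε / 2 := by
    rw [div_le_iff₀ (by positivity)] at hnK ⊢
    linarith
  rw [hL2]
  linarith
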